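/- All Hilbert spaces are complex and separable. Let $n$ be a natural number and let $q_{ij}$ $(1\le i,j\le n)$ be complex numbers with $|q_{ij}|=1$, $q_{ii}=1$ and $q_{ji}=q_{ij}^{-1}$. For an $n$-tuple $\underline R=(R_1,\dots,R_n)$ of bounded operators and a word $\alpha=(\alpha_1,\dots,\alpha_m)$ in $\{1,\dots,n\}$ put $\underline R^\alpha=R_{\alpha_1}\cdots R_{\alpha_m}$, with $\underline R^\alpha=I$ for the empty word. The tuple $\underline R$ is contractive if $\sum_i R_iR_i^*\le I$; its defect operator is then $\Delta_{\underline R}=(I-\sum_i R_iR_i^*)^{1/2}$. It is pure if $\sum_{|\alpha|=m}\underline R^\alpha(\underline R^\alpha)^*\to 0$ strongly as $m\to\infty$. The rank of an operator is the dimension of the closure of its range (finite or $\infty$). For a tuple $\underline R$ on $\mathcal L$ let $\mathcal L^q(\underline R)$ be the largest closed subspace $\mathcal N$ of $\mathcal L$ that is invariant under all $R_i^*$ and satisfies $R_i^*R_j^*h=\overline{q_{ij}}\,R_j^*R_i^*h$ for all $h\in\mathcal N$ and all $i,j$. The maximal $q$-commuting piece $\underline R^q$ of $\underline R$ is the tuple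 of compressions of the $R_i$ to $\mathcal L^q(\underline R)$. Given $\mathcal H\subseteq\mathcal L$, a tuple $\underline R$ on $\mathcal L$ is a dilation of a tuple $\underline T$ on $\mathcal H$ if $R_i^*u=T_i^*u$ for all $u\in\mathcal H$ and all $i$. The standard noncommuting dilation of a contractive tuple $\underline T$ on $\mathcal H$ is its minimal isometric dilation: a dilation $\underline{\tilde V}=(\tilde V_1,\dots,\tilde V_n)$ of $\underline T$ on some $\tilde{\mathcal H}\supseteq\mathcal H$ consisting of isometries with mutually orthogonal ranges, with $\overline{\mathrm{span}}\{\underline{\tilde V}^\alpha h:\ h\in\mathcal H,\ \alpha \text{ a word}\}=\tilde{\mathcal H}$ (it is unique up to unitary equivalence). Let $V_ix=e_i\otimes x$ be the creation operators on the full Fock space $\Gamma(\mathbb C^n)=\bigoplus_{m\ge0}(\mathbb C^n)^{\otimes m}$, let $\underline S=\underline V^q$ be the maximal $q$-commuting piece of $\underline V=(V_1,\dots,V_n)$, and let $C^*(\underline S)$ be the unital $C^*$-algebra generated by $S_1,\dots,S_n$. The standard $q$-commuting dilation of a $q$-commuting contractive tuple $\underline T$ on $\mathcal H$ (that is, one with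 $T_jT_i=q_{ij}T_iT_j$ for all $i,j$) is the tuple $(\pi(S_1),\dots,\pi(S_n))$, where $\pi:C^*(\underline S)\to B(\mathcal H_1)$, $\mathcal H_1\supseteq\mathcal H$, is the minimal Stinespring dilation of the unital completely positive map $\varphi:C^*(\underline S)\to B(\mathcal H)$ with $\varphi(\underline S^\alpha(\underline S^\beta)^*)=\underline T^\alpha(\underline T^\beta)^*$ for all words $\alpha,\beta$; so $\varphi(X)=P_{\mathcal H}\pi(X)|_{\mathcal H}$ and $\overline{\mathrm{span}}\,\pi(C^*(\underline S))\mathcal H=\mathcal H_1$. **Theorem.** Let $\underline T$ be a pure contractive $n$-tuple on a Hilbert space $\mathcal H$, and let $\underline{\tilde V}$ on $\tilde{\mathcal H}\supseteq\mathcal H$ be its standard noncommuting dilation; then $\mathcal H^q(\underline T)\subseteq\tilde{\mathcal H}^q(\underline{\tilde V})$. 1. The maximal $q$-commuting piece $\underline{\tilde V}^q$ on $\tilde{\mathcal H}^q(\underline{\tilde V})\supseteq\mathcal H^q(\underline T)$ is a realization of the standard $q$-commuting dilation of $\underline T^q$ if and only if $\overline{\Delta_{\underline T}(\mathcal H)}=\overline{\Delta_{\underline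 T}(\mathcal H^q(\underline T))}$. If this equality holds, then $\operatorname{rank}\Delta_{\underline T}=\operatorname{rank}\Delta_{\underline T^q}=\operatorname{rank}\Delta_{\underline{\tilde V}}=\operatorname{rank}\Delta_{\underline{\tilde V}^q}$. 2. If $\operatorname{rank}\Delta_{\underline T}$ and $\operatorname{rank}\Delta_{\underline T^q}$ are finite and equal, then $\underline{\tilde V}^q$ is a realization of the standard $q$-commuting dilation of $\underline T^q$. -/

import Mathlib

noncomputable section

namespace QDilation

open Filter Topology ContinuousLinearMap

section Words

/-- The product `T_{α₁} T_{α₂} ⋯ T_{αₘ}` of a tuple along a word `α`; the empty word gives `1`. -/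
def wordProd {n : ℕ} {A : Type*} [Monoid A] (T : Fin n → A) (α : List (Fin n)) : A :=
  (α.map T).prod

end Words

section Tuples

variable {n : ℕ} {H L : Type*}
  [NormedAddCommGroup H] [InnerProductSpace ℂ H] [CompleteSpace H]
  [NormedAddCommGroup L] [InnerProductSpace ℂ L] [CompleteSpace L]

/-- Row contraction: `∑ Tᵢ Tᵢ* ≤ I`. -/
def IsContractive (T : Fin n → H →L[ℂ] H) : Prop :=
  ∑ i, T i * adjoint (T i) ≤ 1

/-- Pure tuple: `∑_{|α| = m} T^α (T^α)*` tends to `0` strongly as `m → ∞`. -/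
def IsPure (T : Fin n → H →L[ℂ] H) : Prop :=
  ∀ h : H, Tendsto
    (fun m : ℕ => ∑ α : Fin m → Fin n,
      (wordProd T (List.ofFn α) * adjoint (wordProd T (List.ofFn α))) h)
    atTop (𝓝 0)

/-- The defect operator `Δ_T = (I - ∑ Tᵢ Tᵢ*)^{1/2}` (positive square root). -/
def defect (T : Fin n → H →L[ℂ] H) : H →L[ℂ] H :=
  CFC.sqrt (1 - ∑ i, T i * adjoint (T i))

/-- The rank of an operator, with value `⊤` when it is infinite. -/
def opRank (A : H →L[ℂ] H) : ℕ∞ :=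
  Cardinal.toENat (LinearMap.rank (A : H →ₗ[ℂ] H))

/-- `R` on `L` is a dilation of `T` on `H`, where `H` is viewed as a closed subspace of `L`
through the isometry `J`: `Rᵢ* u = Tᵢ* u` for `u` in `H`. -/
def IsDilation (J : H →ₗᵢ[ℂ] L) (T : Fin n → H →L[ℂ] H) (R : Fin n → L →L[ℂ] L) : Prop :=
  ∀ i, ∀ u : H, adjoint (R i) (J u) = J (adjoint (T i) u)

/-- The standard noncommuting dilation (minimal isometric dilation): a dilation by isometries
with mutually orthogonal ranges such that the vectors `R^α h`, `h ∈ H`, span a dense subspace. -/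
structure IsStandardNoncommutingDilation (J : H →ₗᵢ[ℂ] L) (T : Fin n → H →L[ℂ] H)
    (R : Fin n → L →L[ℂ] L) : Prop where
  dilation : IsDilation J T R
  isometric : ∀ i, adjoint (R i) * R i = 1
  orthogonal : ∀ i j, i ≠ j → adjoint (R i) * R j = 0
  minimal : (Submodule.span ℂ
    {x : L | ∃ (α : List (Fin n)) (h : H), x = wordProd R α (J h)}).topologicalClosure = ⊤

/-- The closed subspaces `N`, invariant under every `Rᵢ*`, on which
`Rᵢ* Rⱼ* = conj(qᵢⱼ) Rⱼ* Rᵢ*` for all `i, j`. -/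
def qSubspaces (q : Fin n → Fin n → ℂ) (R : Fin n → L →L[ℂ] L) : Set (Submodule ℂ L) :=
  {N | IsClosed (N : Set L) ∧ (∀ i, ∀ h ∈ N, adjoint (R i) h ∈ N) ∧
    ∀ i j, ∀ h ∈ N, adjoint (R i) (adjoint (R j) h)
      = (starRingEnd ℂ) (q i j) • adjoint (R j) (adjoint (R i) h)}

/-- The largest member of `qSubspaces q R` (see `isGreatest_maxQ`). -/
def maxQ (q : Fin n → Fin n → ℂ) (R : Fin n → L →L[ℂ] L) : Submodule ℂ L :=
  (sSup (qSubspaces q R)).topologicalClosure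

instance (q : Fin n → Fin n → ℂ) (R : Fin n → L →L[ℂ] L) : CompleteSpace (maxQ q R) :=
  (Submodule.isClosed_topologicalClosure _).completeSpace_coe

/-- The unital C*-algebra generated by the operators `R₁, …, Rₙ`. -/
def generatedCStar (R : Fin n → L →L[ℂ] L) : StarSubalgebra ℂ (L →L[ℂ] L) :=
  (StarAlgebra.adjoin ℂ (Set.range R)).topologicalClosure

/-- `Rᵢ` as an element of the C*-algebra generated by `R₁, …, Rₙ`. -/
def generator (R : Fin n → L →L[ℂ] L) (i : Fin n) : generatedCStar R :=
  ⟨R i, StarSubalgebra.le_topologicalClosure _ (StarAlgebra.subset_adjoin ℂ _ ⟨i, rfl⟩)⟩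

theorem isGreatest_maxQ (q : Fin n → Fin n → ℂ) (R : Fin n → L →L[ℂ] L) :
    IsGreatest (qSubspaces q R) (maxQ q R) := by
  refine ⟨⟨Submodule.isClosed_topologicalClosure _, ?_, ?_⟩, ?_⟩
  · intro i
    have h1 : sSup (qSubspaces q R) ≤
        (sSup (qSubspaces q R)).comap (adjoint (R i) : L →ₗ[ℂ] L) :=
      sSup_le fun N hN x hx => le_sSup hN (hN.2.1 i x hx)
    intro h hh
    exact map_mem_closure (adjoint (R i)).continuous hh (fun x hx => h1 hx)
  · intro i j
    have h1 : maxQ q R ≤ LinearMap.ker ((adjoint (R i) * adjoint (R j)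
        - (starRingEnd ℂ) (q i j) • (adjoint (R j) * adjoint (R i)) : L →L[ℂ] L)
          : L →ₗ[ℂ] L) := by
      refine Submodule.topologicalClosure_minimal _ (sSup_le fun N hN x hx => ?_)
        (ContinuousLinearMap.isClosed_ker _)
      have := hN.2.2 i j x hx
      simp [this]
    intro h hh
    have := h1 hh
    simpa [sub_eq_zero] using this
  · intro N hN
    exact (le_sSup hN).trans (Submodule.le_topologicalClosure _)

/-- The maximal `q`-commuting piece `R^q`: the compression of `R` to `maxQ q R`. -/
def maxPiece (q : Fin n → Fin n → ℂ) (R : Fin n → L →L[ℂ] L) :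
    Fin n → maxQ q R →L[ℂ] maxQ q R :=
  fun i => (maxQ q R).orthogonalProjectionOnto ∘L R i ∘L (maxQ q R).subtypeL

theorem map_mem_maxQ (q : Fin n → Fin n → ℂ) {J : H →ₗᵢ[ℂ] L} {T : Fin n → H →L[ℂ] H}
    {R : Fin n → L →L[ℂ] L} (hJ : IsDilation J T R) (x : maxQ q T) : J x ∈ maxQ q R := by
  have hT := (isGreatest_maxQ q T).1
  have hmem : (maxQ q T).map J.toLinearMap ∈ qSubspaces q R := by
    refine ⟨?_, ?_, ?_⟩
    · have := J.isometry.isClosedEmbedding.isClosedMap _ hT.1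
      simpa using this
    · rintro i _ ⟨h, hh, rfl⟩
      exact ⟨adjoint (T i) h, hT.2.1 i h hh, (hJ i h).symm⟩
    · rintro i j _ ⟨h, hh, rfl⟩
      have e := congrArg J (hT.2.2 i j h hh)
      rw [map_smul] at e
      simpa [hJ _ _] using e
  exact (isGreatest_maxQ q R).2 hmem ⟨x, x.2, rfl⟩

/-- For a dilation `R` of `T`, the inclusion of `H` into `L` restricts to an inclusion of
the space of `T^q` into the space of `R^q`. -/
def restrictEmbedding (q : Fin n → Fin n → ℂ) {J : H →ₗᵢ[ℂ] L} {T : Fin n → H →L[ℂ] H}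
    {R : Fin n → L →L[ℂ] L} (hJ : IsDilation J T R) : maxQ q T →ₗᵢ[ℂ] maxQ q R where
  toLinearMap := (J.toLinearMap ∘ₗ (maxQ q T).subtype).codRestrict (maxQ q R)
    (fun x => map_mem_maxQ q hJ x)
  norm_map' x := J.norm_map (x : H)

end Tuples

section Fock

/-- The full Fock space over `ℂⁿ`, in coordinates: `ℂⁿ ⊗ ⋯ ⊗ ℂⁿ` (`m` factors) has orthonormal
basis `e_{α₁} ⊗ ⋯ ⊗ e_{αₘ}` indexed by the words of length `m`, so the Hilbert sum over all `m`
is `ℓ²` of the set of all words; the empty word is the vacuum. -/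
abbrev FullFock (n : ℕ) : Type := lp (fun _ : List (Fin n) => ℂ) 2

/-- Coordinates of `eᵢ ⊗ x`. -/
def creationFun {n : ℕ} (i : Fin n) (x : List (Fin n) → ℂ) : List (Fin n) → ℂ
  | [] => 0
  | j :: α => if j = i then x α else 0

theorem support_creationFun {n : ℕ} (i : Fin n) (x : List (Fin n) → ℂ) :
    Function.support (fun w => ‖creationFun i x w‖ ^ (2 : ℝ)) ⊆
      Set.range (fun α => i :: α) := by
  intro w hw
  cases w with
  | nil => simp [creationFun] at hw
  | cons j α =>
    by_cases h : j = i
    · exact ⟨α, by rw [h]⟩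
    · simp [creationFun, h] at hw

theorem creationFun_memℓp {n : ℕ} (i : Fin n) (x : FullFock n) :
    Memℓp (creationFun i x) 2 := by
  apply memℓp_gen
  have hx : Summable fun α => ‖x α‖ ^ (2 : ℝ) := by
    simpa using (lp.memℓp x).summable (by norm_num)
  have hs := support_creationFun i x
  have : Summable fun w => ‖creationFun i x w‖ ^ (2 : ℝ) := by
    rw [← Function.Injective.summable_iff (List.cons_injective (a := i))]
    · simpa [Function.comp_def, creationFun] using hx
    · intro w hw
      by_contra h
      exact hw (hs h)
  simpa using this

/-- The creation operator `Vᵢ x = eᵢ ⊗ x` on the full Fock space, an isometry. -/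
def creationIsometry {n : ℕ} (i : Fin n) : FullFock n →ₗᵢ[ℂ] FullFock n where
  toFun x := ⟨creationFun i x, creationFun_memℓp i x⟩
  map_add' x y := by
    ext w
    cases w with
    | nil => exact (add_zero (0 : ℂ)).symm
    | cons j α =>
      change creationFun i (⇑x + ⇑y) (j :: α) = creationFun i x (j :: α) + creationFun i y (j :: α)
      by_cases h : j = i <;> simp [creationFun, h]
  map_smul' c x := by
    ext w
    cases w with
    | nil => simp [creationFun]
    | cons j α => by_cases h : j = i <;> simp [creationFun, h]
  norm_map' x := by
    rw [lp.norm_eq_tsum_rpow (by norm_num), lp.norm_eq_tsum_rpow (by norm_num)]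
    congr 1
    have h := Function.Injective.tsum_eq (List.cons_injective (a := i))
      (support_creationFun i x)
    simpa [creationFun] using h.symm

/-- The tuple `V = (V₁, …, Vₙ)` of creation operators. -/
def creation (n : ℕ) : Fin n → FullFock n →L[ℂ] FullFock n :=
  fun i => (creationIsometry i).toContinuousLinearMap

variable {n : ℕ} (q : Fin n → Fin n → ℂ)

/-- The `q`-commuting Fock space: the maximal `q`-commuting subspace of `V`. -/
abbrev QFock : Submodule ℂ (FullFock n) := maxQ q (creation n)

/-- The tuple `S`: compression of `V` to the `q`-commuting Fock space. -/
def qShift : Fin n → QFock q →L[ℂ] QFock q := maxPiece q (creation n)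

/-- The unital C*-algebra `C*(S)` generated by `S₁, …, Sₙ`. -/
abbrev CStarS : StarSubalgebra ℂ (QFock q →L[ℂ] QFock q) := generatedCStar (qShift q)

/-- `Sᵢ` as an element of `C*(S)`. -/
def qShiftGen (i : Fin n) : CStarS q := generator (qShift q) i

variable {H L : Type*}
  [NormedAddCommGroup H] [InnerProductSpace ℂ H] [CompleteSpace H]
  [NormedAddCommGroup L] [InnerProductSpace ℂ L] [CompleteSpace L]

open scoped ComplexOrder in
/-- Complete positivity of a map of `C*(S)` into `B(H)`:
`∑ᵢⱼ ⟨φ(Xᵢ* Xⱼ) hⱼ, hᵢ⟩ ≥ 0` for all finite families. -/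
def IsCompletelyPositive (φ : CStarS q →ₗ[ℂ] (H →L[ℂ] H)) : Prop :=
  ∀ (k : ℕ) (X : Fin k → CStarS q) (h : Fin k → H),
    0 ≤ ∑ i, ∑ j, inner ℂ (h i) (φ (star (X i) * X j) (h j))

/-- `W` on `L` is (a realization of) the standard `q`-commuting dilation of `T` on `H`, with `H`
contained in `L` through `J`: there are a unital completely positive map `φ : C*(S) → B(H)` with
`φ(S^α (S^β)*) = T^α (T^β)*` and a minimal Stinespring dilation `π : C*(S) → B(L)` of `φ`
such that `Wᵢ = π(Sᵢ)`. -/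
def IsStandardQCommutingDilation (J : H →ₗᵢ[ℂ] L) (T : Fin n → H →L[ℂ] H)
    (W : Fin n → L →L[ℂ] L) : Prop :=
  ∃ (φ : CStarS q →ₗ[ℂ] (H →L[ℂ] H)) (π : CStarS q →⋆ₐ[ℂ] (L →L[ℂ] L)),
    φ 1 = 1 ∧ IsCompletelyPositive q φ ∧
    (∀ α β : List (Fin n),
      φ (wordProd (qShiftGen q) α * star (wordProd (qShiftGen q) β))
        = wordProd T α * adjoint (wordProd T β)) ∧
    (∀ X : CStarS q,
      φ X = adjoint J.toContinuousLinearMap ∘L π X ∘L J.toContinuousLinearMap) ∧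
    (Submodule.span ℂ
      {x : L | ∃ (X : CStarS q) (h : H), x = π X (J h)}).topologicalClosure = ⊤ ∧
    ∀ i, π (qShiftGen q i) = W i

end Fock

end QDilation

end

noncomputable section

namespace QDilation

open Filter Topology ContinuousLinearMap


/-! ### Adjoints along words, compressions to the maximal piece, and defect norms. -/

section Tuples

variable {n : ℕ} {H L : Type*}
  [NormedAddCommGroup H] [InnerProductSpace ℂ H] [CompleteSpace H]
  [NormedAddCommGroup L] [InnerProductSpace ℂ L] [CompleteSpace L]

/-! Everything is read off from the wandering subspace `W = ⋂ ker Vᵢ*` and its projection `P = I - ∑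
Vᵢ Vᵢ*`. Since `‖P J h‖ = ‖Δ_T h‖`, the map `Δ_T h ↦ P J h` is isometric. By minimality of `V` its
range is dense in `W`. Thus the defect condition says exactly that `P J (maxQ q T)` is dense in `W`
(`closure_range_defect_eq_iff`).

Purity makes the translates `V^α W` total (`eq_zero_of_wanderingProj`). Each unit vector of `W`
generates a copy of the full Fock space that reduces `V`, and the maximal piece of that copy is a
copy of `QFock q`. An orthonormal basis of `W` therefore turns `V^q` into `S ⊗ I`
(`exists_isHilbertSum_qFock`), which gives the representation `π` with `π(Sᵢ) = Vᵢ^q`. Its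
compression is the required completely positive map because `V^q` dilates `T^q`, so only minimality
is in question.

A vector `d` of `W` orthogonal to `P J (maxQ q T)` is orthogonal to all of `π(C*(S)) J (maxQ q T)`,
since the Fock copy of `d` is stable under `π`. Conversely, the elements `S^α (1 - ∑ Sᵢ Sᵢ*)` of
`C*(S)` show that if `y` is orthogonal to that span, then each `P (V^α)* y` is orthogonal to `P J
(maxQ q T)`. Density makes these vectors vanish, and purity gives `y = 0`.

The defect operators of `V` and of `V^q` both have the rank of `W`, because `W ≤ maxQ q V`; those of
`T` and `T^q` have the ranks of `P J H` and `P J (maxQ q T)`. In the finite case, nested ranges of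
equal dimension coincide. -/

@[simp] theorem wordProd_nil {A : Type*} [Monoid A] (T : Fin n → A) : wordProd T [] = 1 := rfl

@[simp] theorem wordProd_cons {A : Type*} [Monoid A] (T : Fin n → A) (i : Fin n)
    (α : List (Fin n)) : wordProd T (i :: α) = T i * wordProd T α := by
  simp [wordProd]

omit [CompleteSpace H] in
theorem wordProd_cons_apply (T : Fin n → H →L[ℂ] H) (i : Fin n) (α : List (Fin n)) (h : H) :
    wordProd T (i :: α) h = T i (wordProd T α h) := by
  rw [wordProd_cons]; rfl

theorem map_wordProd {A B F : Type*} [Monoid A] [Monoid B] [FunLike F A B] [MonoidHomClass F A B]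
    (f : F) (T : Fin n → A) (α : List (Fin n)) :
    f (wordProd T α) = wordProd (fun i => f (T i)) α := by
  induction α with
  | nil => simp
  | cons i α ih => simp [ih]

theorem adjoint_wordProd_cons_apply (T : Fin n → H →L[ℂ] H) (i : Fin n) (α : List (Fin n))
    (h : H) : adjoint (wordProd T (i :: α)) h = adjoint (wordProd T α) (adjoint (T i) h) := by
  rw [wordProd_cons, ← star_eq_adjoint, star_mul]; rfl

@[simp] theorem adjoint_one_apply (h : H) : adjoint (1 : H →L[ℂ] H) h = h := by
  rw [← star_eq_adjoint, star_one]; rfl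

theorem IsDilation.wordProd {J : H →ₗᵢ[ℂ] L} {T : Fin n → H →L[ℂ] H} {R : Fin n → L →L[ℂ] L}
    (hJ : IsDilation J T R) (α : List (Fin n)) (u : H) :
    adjoint (wordProd R α) (J u) = J (adjoint (wordProd T α) u) := by
  induction α generalizing u with
  | nil => simp
  | cons i α ih => rw [adjoint_wordProd_cons_apply, adjoint_wordProd_cons_apply, hJ, ih]

theorem adjoint_mem_maxQ (q : Fin n → Fin n → ℂ) (R : Fin n → L →L[ℂ] L) (i : Fin n) {x : L}
    (hx : x ∈ maxQ q R) : adjoint (R i) x ∈ maxQ q R :=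
  (isGreatest_maxQ q R).1.2.1 i x hx

/-- The adjoints of the maximal `q`-commuting piece are restrictions of the adjoints. -/
theorem coe_adjoint_maxPiece (q : Fin n → Fin n → ℂ) (R : Fin n → L →L[ℂ] L) (i : Fin n)
    (x : maxQ q R) : (adjoint (maxPiece q R i) x : L) = adjoint (R i) x := by
  have h : adjoint (maxPiece q R i) x = ⟨adjoint (R i) x, adjoint_mem_maxQ q R i x.2⟩ := by
    refine ext_inner_right ℂ fun y => ?_
    rw [adjoint_inner_left, Submodule.coe_inner, Submodule.coe_inner]
    change inner ℂ (x : L) ((maxQ q R).orthogonalProjectionOnto (R i y) : L)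
      = inner ℂ (adjoint (R i) x) (y : L)
    rw [adjoint_inner_left, ← Submodule.coe_inner,
      Submodule.inner_orthogonalProjectionOnto_eq_of_mem_left]
  rw [h]

theorem isDilation_subtype_maxQ (q : Fin n → Fin n → ℂ) (R : Fin n → L →L[ℂ] L) :
    IsDilation (maxQ q R).subtypeₗᵢ (maxPiece q R) R :=
  fun i u => (coe_adjoint_maxPiece q R i u).symm

theorem isDilation_restrictEmbedding (q : Fin n → Fin n → ℂ) {J : H →ₗᵢ[ℂ] L}
    {T : Fin n → H →L[ℂ] H} {R : Fin n → L →L[ℂ] L} (hJ : IsDilation J T R) :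
    IsDilation (restrictEmbedding q hJ) (maxPiece q T) (maxPiece q R) := by
  intro i u
  apply Subtype.ext
  rw [coe_adjoint_maxPiece]
  change adjoint (R i) (J u) = J (adjoint (maxPiece q T i) u : H)
  rw [coe_adjoint_maxPiece, hJ]

theorem inner_sub_sum_mul_adjoint (T : Fin n → H →L[ℂ] H) (h : H) :
    inner ℂ ((1 - ∑ i, T i * adjoint (T i)) h) h
      = ((‖h‖ ^ 2 - ∑ i, ‖adjoint (T i) h‖ ^ 2 : ℝ) : ℂ) := by
  simp only [sub_apply, one_apply_eq_self, sum_apply, inner_sub_left, sum_inner]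
  push_cast
  congr 1
  · exact inner_self_eq_norm_sq_to_K h
  · refine Finset.sum_congr rfl fun i _ => ?_
    change inner ℂ (T i (adjoint (T i) h)) h = _
    rw [← adjoint_inner_right]
    exact inner_self_eq_norm_sq_to_K _

theorem isContractive_iff (T : Fin n → H →L[ℂ] H) :
    IsContractive T ↔ ∀ h, ∑ i, ‖adjoint (T i) h‖ ^ 2 ≤ ‖h‖ ^ 2 := by
  rw [IsContractive, ContinuousLinearMap.le_def, isPositive_iff_complex]
  simp only [inner_sub_sum_mul_adjoint, RCLike.re_to_complex, Complex.ofReal_re, true_and,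
    sub_nonneg]

theorem isContractive_maxPiece (q : Fin n → Fin n → ℂ) {R : Fin n → L →L[ℂ] L}
    (hR : IsContractive R) : IsContractive (maxPiece q R) := by
  rw [isContractive_iff] at hR ⊢
  intro h
  have := hR h
  simp only [← coe_adjoint_maxPiece] at this
  exact this

/-- The square root is self-adjoint and squares to `1 - ∑ Tᵢ Tᵢ*`. Later arguments use the defect
only through this norm formula. -/
theorem norm_sq_defect {T : Fin n → H →L[ℂ] H} (hT : IsContractive T) (h : H) :
    ‖defect T h‖ ^ 2 = ‖h‖ ^ 2 - ∑ i, ‖adjoint (T i) h‖ ^ 2 := by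
  have h0 : 0 ≤ 1 - ∑ i, T i * adjoint (T i) := sub_nonneg.2 hT
  have hs : adjoint (defect T) = defect T :=
    (IsSelfAdjoint.of_nonneg (CFC.sqrt_nonneg _)).star_eq
  have hm : defect T * defect T = 1 - ∑ i, T i * adjoint (T i) := CFC.sqrt_mul_sqrt_self _ h0
  have e : ((‖defect T h‖ ^ 2 : ℝ) : ℂ) = inner ℂ ((1 - ∑ i, T i * adjoint (T i)) h) h := by
    rw [← hm]
    change _ = inner ℂ (defect T (defect T h)) h
    rw [← adjoint_inner_right, hs]
    push_cast
    exact (inner_self_eq_norm_sq_to_K (𝕜 := ℂ) (defect T h)).symm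
  rw [inner_sub_sum_mul_adjoint] at e
  exact_mod_cast e

theorem norm_defect_maxPiece (q : Fin n → Fin n → ℂ) {R : Fin n → L →L[ℂ] L}
    (hR : IsContractive R) (x : maxQ q R) : ‖defect (maxPiece q R) x‖ = ‖defect R x‖ := by
  have h : ‖defect (maxPiece q R) x‖ ^ 2 = ‖defect R x‖ ^ 2 := by
    rw [norm_sq_defect hR, norm_sq_defect (isContractive_maxPiece q hR)]
    simp only [← coe_adjoint_maxPiece]
    rfl
  exact (sq_eq_sq₀ (norm_nonneg _) (norm_nonneg _)).1 h

end Tuples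

/-! ### The wandering subspace of a row isometry. -/

section Wandering

variable {n : ℕ} {H L : Type*}
  [NormedAddCommGroup H] [InnerProductSpace ℂ H] [CompleteSpace H]
  [NormedAddCommGroup L] [InnerProductSpace ℂ L] [CompleteSpace L]

/-- The wandering subspace of a tuple: the common kernel of the adjoints. -/
def wandering (V : Fin n → L →L[ℂ] L) : Submodule ℂ L :=
  ⨅ i, LinearMap.ker (adjoint (V i) : L →ₗ[ℂ] L)

theorem mem_wandering {V : Fin n → L →L[ℂ] L} {x : L} :
    x ∈ wandering V ↔ ∀ i, adjoint (V i) x = 0 := by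
  simp [wandering]

theorem isClosed_wandering (V : Fin n → L →L[ℂ] L) : IsClosed (wandering V : Set L) := by
  rw [wandering, Submodule.coe_iInf]
  exact isClosed_iInter fun i => ContinuousLinearMap.isClosed_ker _

instance (V : Fin n → L →L[ℂ] L) : CompleteSpace (wandering V) :=
  (isClosed_wandering V).completeSpace_coe

/-- All adjoints vanish on the wandering subspace, so invariance and the `q`-relations are trivial
there. -/
theorem wandering_le_maxQ (q : Fin n → Fin n → ℂ) (V : Fin n → L →L[ℂ] L) :
    wandering V ≤ maxQ q V := by
  refine (isGreatest_maxQ q V).2 ⟨isClosed_wandering V, fun i h hh => ?_, fun i j h hh => ?_⟩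
  · rw [mem_wandering.1 hh i]; exact zero_mem _
  · simp [mem_wandering.1 hh]

/-- `I - ∑ Vᵢ Vᵢ*`; for isometries with orthogonal ranges this is the projection onto the
wandering subspace. -/
def wanderingProj (V : Fin n → L →L[ℂ] L) : L →L[ℂ] L := 1 - ∑ i, V i * adjoint (V i)

theorem wanderingProj_apply (V : Fin n → L →L[ℂ] L) (x : L) :
    wanderingProj V x = x - ∑ i, V i (adjoint (V i) x) := by
  simp [wanderingProj]

/-- Isometries with mutually orthogonal ranges. -/
def IsRowIsometry (V : Fin n → L →L[ℂ] L) : Prop :=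
  ∀ i j x, adjoint (V i) (V j x) = if i = j then x else 0

theorem IsStandardNoncommutingDilation.isRowIsometry {J : H →ₗᵢ[ℂ] L} {T : Fin n → H →L[ℂ] H}
    {V : Fin n → L →L[ℂ] L} (hV : IsStandardNoncommutingDilation J T V) : IsRowIsometry V := by
  intro i j x
  split_ifs with h
  · subst h; exact DFunLike.congr_fun (hV.isometric i) x
  · exact DFunLike.congr_fun (hV.orthogonal i j h) x

theorem adjoint_wanderingProj (V : Fin n → L →L[ℂ] L) :
    adjoint (wanderingProj V) = wanderingProj V := by
  rw [← star_eq_adjoint]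
  simp [wanderingProj, ← star_eq_adjoint, star_sum]

theorem inner_wanderingProj_left (V : Fin n → L →L[ℂ] L) (x y : L) :
    inner ℂ (wanderingProj V x) y = inner ℂ x (wanderingProj V y) := by
  rw [← adjoint_inner_right, adjoint_wanderingProj]

theorem wanderingProj_of_mem {V : Fin n → L →L[ℂ] L} {x : L} (hx : x ∈ wandering V) :
    wanderingProj V x = x := by
  simp [wanderingProj_apply, mem_wandering.1 hx]

theorem IsRowIsometry.wanderingProj_mem {V : Fin n → L →L[ℂ] L} (hV : IsRowIsometry V) (x : L) :
    wanderingProj V x ∈ wandering V := by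
  rw [mem_wandering]
  intro i
  simp [wanderingProj_apply, hV i]

theorem IsRowIsometry.norm_sq_wanderingProj {V : Fin n → L →L[ℂ] L} (hV : IsRowIsometry V)
    (x : L) : ‖wanderingProj V x‖ ^ 2 = ‖x‖ ^ 2 - ∑ i, ‖adjoint (V i) x‖ ^ 2 := by
  have e : ((‖wanderingProj V x‖ ^ 2 : ℝ) : ℂ)
      = ((‖x‖ ^ 2 - ∑ i, ‖adjoint (V i) x‖ ^ 2 : ℝ) : ℂ) := by
    rw [← inner_sub_sum_mul_adjoint]
    change _ = inner ℂ (wanderingProj V x) x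
    have h := inner_wanderingProj_left V (wanderingProj V x) x
    rw [wanderingProj_of_mem (hV.wanderingProj_mem x)] at h
    rw [h]
    push_cast
    exact (inner_self_eq_norm_sq_to_K (𝕜 := ℂ) (wanderingProj V x)).symm
  exact_mod_cast e

theorem IsRowIsometry.isContractive {V : Fin n → L →L[ℂ] L} (hV : IsRowIsometry V) :
    IsContractive V := by
  rw [isContractive_iff]
  intro x
  have := hV.norm_sq_wanderingProj x
  nlinarith [sq_nonneg ‖wanderingProj V x‖]

theorem IsRowIsometry.norm_defect {V : Fin n → L →L[ℂ] L} (hV : IsRowIsometry V) (x : L) :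
    ‖defect V x‖ = ‖wanderingProj V x‖ := by
  refine (sq_eq_sq₀ (norm_nonneg _) (norm_nonneg _)).1 ?_
  rw [norm_sq_defect hV.isContractive, hV.norm_sq_wanderingProj]

/-- This transfers questions about the range of the defect operator to the wandering subspace: both
squared norms equal `‖h‖² - ∑ ‖Tᵢ* h‖²`. -/
theorem IsRowIsometry.norm_wanderingProj_of_isDilation {J : H →ₗᵢ[ℂ] L} {T : Fin n → H →L[ℂ] H}
    {V : Fin n → L →L[ℂ] L} (hV : IsRowIsometry V) (hT : IsContractive T)
    (hJ : IsDilation J T V) (h : H) : ‖wanderingProj V (J h)‖ = ‖defect T h‖ := by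
  refine (sq_eq_sq₀ (norm_nonneg _) (norm_nonneg _)).1 ?_
  rw [norm_sq_defect hT, hV.norm_sq_wanderingProj]
  simp [hJ _ h]

/-- Equal first letters cancel and different ones give orthogonal ranges. If one word runs out
first, an adjoint hits a wandering vector. -/
theorem IsRowIsometry.inner_wordProd {V : Fin n → L →L[ℂ] L} (hV : IsRowIsometry V) {d e : L}
    (hd : d ∈ wandering V) (he : e ∈ wandering V) (α β : List (Fin n)) :
    inner ℂ (wordProd V α d) (wordProd V β e) = if α = β then inner ℂ d e else 0 := by
  induction α generalizing β with
  | nil =>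
    cases β with
    | nil => simp
    | cons j β =>
      rw [wordProd_nil, wordProd_cons_apply, one_apply_eq_self]
      rw [← adjoint_inner_left, mem_wandering.1 hd]
      simp
  | cons i α ih =>
    cases β with
    | nil =>
      rw [wordProd_nil, wordProd_cons_apply, one_apply_eq_self]
      rw [← adjoint_inner_right, mem_wandering.1 he]
      simp
    | cons j β =>
      rw [wordProd_cons_apply, wordProd_cons_apply]
      rw [← adjoint_inner_right, hV i j]
      by_cases hij : i = j
      · simp [hij, ih]
      · simp [hij]

end Wandering


/-! ### Consequences of purity and of minimality. -/

section Pure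

variable {n : ℕ} {H L : Type*}
  [NormedAddCommGroup H] [InnerProductSpace ℂ H] [CompleteSpace H]
  [NormedAddCommGroup L] [InnerProductSpace ℂ L] [CompleteSpace L]

theorem wordProd_append {A : Type*} [Monoid A] (T : Fin n → A) (α β : List (Fin n)) :
    wordProd T (α ++ β) = wordProd T α * wordProd T β := by
  simp [wordProd]

theorem adjoint_wordProd_append_apply (T : Fin n → H →L[ℂ] H) (α β : List (Fin n)) (h : H) :
    adjoint (wordProd T (α ++ β)) h = adjoint (wordProd T β) (adjoint (wordProd T α) h) := by
  rw [wordProd_append, ← star_eq_adjoint, star_mul]; rfl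

/-- The hypothesis says that `∑ Vᵢ Vᵢ*` fixes every `(V^α)* y`, so the identity can be iterated, one
letter at a time. -/
theorem sum_wordProd_adjoint_of_wanderingProj_eq_zero (V : Fin n → L →L[ℂ] L) (m : ℕ) {y : L}
    (hy : ∀ α, wanderingProj V (adjoint (wordProd V α) y) = 0) :
    ∑ α : Fin m → Fin n,
      (wordProd V (List.ofFn α) * adjoint (wordProd V (List.ofFn α))) y = y := by
  induction m generalizing y with
  | zero => simp
  | succ m ih =>
    rw [← (Fin.consEquiv (fun _ => Fin n)).sum_comp, Fintype.sum_prod_type]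
    have key : ∀ i, ∑ β : Fin m → Fin n,
        (wordProd V (List.ofFn (Fin.consEquiv (fun _ => Fin n) (i, β))) *
          adjoint (wordProd V (List.ofFn (Fin.consEquiv (fun _ => Fin n) (i, β))))) y
        = V i (adjoint (V i) y) := by
      intro i
      have hi := ih (y := adjoint (V i) y) fun α => by
        rw [← adjoint_wordProd_cons_apply]; exact hy _
      conv_rhs => rw [← hi, map_sum]
      refine Finset.sum_congr rfl fun β _ => ?_
      have hw : List.ofFn (Fin.consEquiv (fun _ => Fin n) (i, β)) = i :: List.ofFn β := by
        simp [Fin.consEquiv, List.ofFn_succ]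
      rw [hw]
      change wordProd V (i :: List.ofFn β) (adjoint (wordProd V (i :: List.ofFn β)) y) = _
      rw [wordProd_cons_apply, adjoint_wordProd_cons_apply]
      rfl
    rw [Finset.sum_congr rfl fun i _ => key i]
    have h0 := hy []
    simp only [wordProd_nil, adjoint_one_apply, wanderingProj_apply] at h0
    exact (sub_eq_zero.1 h0).symm

theorem sum_norm_sq_adjoint_wordProd (T : Fin n → H →L[ℂ] H) (m : ℕ) (h : H) :
    ((∑ α : Fin m → Fin n, ‖adjoint (wordProd T (List.ofFn α)) h‖ ^ 2 : ℝ) : ℂ)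
      = inner ℂ (∑ α : Fin m → Fin n,
          (wordProd T (List.ofFn α) * adjoint (wordProd T (List.ofFn α))) h) h := by
  rw [sum_inner]
  push_cast
  refine Finset.sum_congr rfl fun α _ => ?_
  change _ = inner ℂ (wordProd T (List.ofFn α) (adjoint (wordProd T (List.ofFn α)) h)) h
  rw [← adjoint_inner_right]
  exact (inner_self_eq_norm_sq_to_K (𝕜 := ℂ) (adjoint (wordProd T (List.ofFn α)) h)).symm

/-- Expanding `y` over words of length `m` and applying Cauchy–Schwarz leaves two factors: the one
from `y` stays equal to `‖y‖²`, and the one from `h` tends to `0` by purity. -/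
theorem IsPure.inner_eq_zero {J : H →ₗᵢ[ℂ] L} {T : Fin n → H →L[ℂ] H} {V : Fin n → L →L[ℂ] L}
    (hpure : IsPure T) (hJ : IsDilation J T V) {y : L}
    (hy : ∀ α, wanderingProj V (adjoint (wordProd V α) y) = 0) (h : H) :
    inner ℂ y (J h) = 0 := by
  have hbound : ∀ m : ℕ, ‖inner ℂ y (J h)‖ ^ 2 ≤ ‖y‖ ^ 2 *
      ‖∑ α : Fin m → Fin n,
        (wordProd T (List.ofFn α) * adjoint (wordProd T (List.ofFn α))) h‖ * ‖h‖ := by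
    intro m
    have hyy := sum_norm_sq_adjoint_wordProd V m y
    rw [sum_wordProd_adjoint_of_wanderingProj_eq_zero V m hy,
      inner_self_eq_norm_sq_to_K (𝕜 := ℂ) y] at hyy
    have hyy' : ∑ α : Fin m → Fin n, ‖adjoint (wordProd V (List.ofFn α)) y‖ ^ 2 = ‖y‖ ^ 2 := by
      exact Complex.ofReal_injective (hyy.trans (by push_cast; rfl))
    have hTT : ∑ α : Fin m → Fin n, ‖adjoint (wordProd T (List.ofFn α)) h‖ ^ 2
        ≤ ‖∑ α : Fin m → Fin n,
          (wordProd T (List.ofFn α) * adjoint (wordProd T (List.ofFn α))) h‖ * ‖h‖ := by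
      refine le_trans (le_abs_self _) ?_
      rw [← Real.norm_eq_abs, ← Complex.norm_real, sum_norm_sq_adjoint_wordProd]
      exact norm_inner_le_norm _ _
    have hin : ‖inner ℂ y (J h)‖ ≤ ∑ α : Fin m → Fin n,
        ‖adjoint (wordProd V (List.ofFn α)) y‖ * ‖adjoint (wordProd T (List.ofFn α)) h‖ := by
      conv_lhs => rw [← sum_wordProd_adjoint_of_wanderingProj_eq_zero V m hy, sum_inner]
      refine (norm_sum_le _ _).trans (Finset.sum_le_sum fun α _ => ?_)
      change ‖inner ℂ (wordProd V (List.ofFn α) (adjoint (wordProd V (List.ofFn α)) y)) (J h)‖ ≤ _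
      rw [← adjoint_inner_right, hJ.wordProd, ← J.norm_map (adjoint _ h)]
      exact norm_inner_le_norm _ _
    calc ‖inner ℂ y (J h)‖ ^ 2 ≤ _ := pow_le_pow_left₀ (norm_nonneg _) hin 2
      _ ≤ _ := Finset.sum_mul_sq_le_sq_mul_sq _ _ _
      _ ≤ _ := by
        rw [hyy', mul_assoc]
        exact mul_le_mul_of_nonneg_left hTT (sq_nonneg _)
  have hlim : Tendsto (fun m : ℕ => ‖y‖ ^ 2 * ‖∑ α : Fin m → Fin n,
      (wordProd T (List.ofFn α) * adjoint (wordProd T (List.ofFn α))) h‖ * ‖h‖) atTop (𝓝 0) := by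
    have := (((hpure h).norm).const_mul (‖y‖ ^ 2)).mul_const ‖h‖
    simpa using this
  have := ge_of_tendsto' hlim hbound
  exact norm_eq_zero.1 (pow_eq_zero_iff two_ne_zero |>.1 (le_antisymm this (sq_nonneg _)))

variable {J : H →ₗᵢ[ℂ] L} {T : Fin n → H →L[ℂ] H} {V : Fin n → L →L[ℂ] L}

theorem IsStandardNoncommutingDilation.eq_zero_of_inner
    (hV : IsStandardNoncommutingDilation J T V) {y : L}
    (hy : ∀ α h, inner ℂ (wordProd V α (J h)) y = 0) : y = 0 := by
  have hmem : y ∈ (Submodule.span ℂ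
      {x : L | ∃ (α : List (Fin n)) (h : H), x = wordProd V α (J h)})ᗮ := by
    rw [Submodule.mem_orthogonal]
    intro u hu
    induction hu using Submodule.span_induction with
    | mem x hx => obtain ⟨α, h, rfl⟩ := hx; exact hy α h
    | zero => simp
    | add a b _ _ ha hb => rw [inner_add_left, ha, hb, add_zero]
    | smul c a _ ha => rw [inner_smul_left, ha, mul_zero]
  rw [Submodule.topologicalClosure_eq_top_iff.1 hV.minimal] at hmem
  exact hmem

/-- Purity: the translates of the wandering subspace span a dense subspace. -/
theorem IsStandardNoncommutingDilation.eq_zero_of_wanderingProj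
    (hV : IsStandardNoncommutingDilation J T V) (hpure : IsPure T) {y : L}
    (hy : ∀ α, wanderingProj V (adjoint (wordProd V α) y) = 0) : y = 0 := by
  refine hV.eq_zero_of_inner fun β h => ?_
  rw [inner_eq_zero_symm, ← adjoint_inner_left]
  -- The vector tested against `J h` is `(V^β)* y`; it inherits the hypothesis on `y` by
  -- concatenating words.
  refine hpure.inner_eq_zero hV.dilation (fun α => ?_) h
  rw [← adjoint_wordProd_append_apply]
  exact hy _

theorem inner_wordProd_of_mem_wandering (hJ : IsDilation J T V) {d : L} (hd : d ∈ wandering V)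
    {h : H} (hh : ∀ α, inner ℂ d (wanderingProj V (J (adjoint (wordProd T α) h))) = 0)
    (α : List (Fin n)) : inner ℂ (wordProd V α d) (J h) = 0 := by
  rw [← adjoint_inner_right, hJ.wordProd, ← wanderingProj_of_mem hd, inner_wanderingProj_left]
  exact hh α

/-- The compressions of the vectors of `H` are dense in the wandering subspace. -/
theorem IsStandardNoncommutingDilation.eq_zero_of_mem_wandering
    (hV : IsStandardNoncommutingDilation J T V) {d : L} (hd : d ∈ wandering V)
    (h0 : ∀ h, inner ℂ (wanderingProj V (J h)) d = 0) : d = 0 := by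
  refine hV.eq_zero_of_inner fun α h => ?_
  cases α with
  | nil =>
    rw [wordProd_nil, one_apply_eq_self, ← wanderingProj_of_mem hd, ← inner_wanderingProj_left]
    exact h0 h
  | cons i α =>
    rw [wordProd_cons_apply, ← adjoint_inner_right, mem_wandering.1 hd, inner_zero_right]

end Pure

/-! ### Functoriality of the maximal `q`-commuting piece. -/

section Maximal

variable {n : ℕ} {L M : Type*}
  [NormedAddCommGroup L] [InnerProductSpace ℂ L] [CompleteSpace L]
  [NormedAddCommGroup M] [InnerProductSpace ℂ M] [CompleteSpace M]

/-- Invariance and the relations pass to the closure by continuity. This allows images of closed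
subspaces, which need not be closed. -/
theorem le_maxQ (q : Fin n → Fin n → ℂ) {R : Fin n → L →L[ℂ] L} {N : Submodule ℂ L}
    (hinv : ∀ i, ∀ h ∈ N, adjoint (R i) h ∈ N)
    (hcomm : ∀ i j, ∀ h ∈ N, adjoint (R i) (adjoint (R j) h)
      = (starRingEnd ℂ) (q i j) • adjoint (R j) (adjoint (R i) h)) : N ≤ maxQ q R := by
  refine N.le_topologicalClosure.trans ((isGreatest_maxQ q R).2
    ⟨N.isClosed_topologicalClosure, fun i h hh => ?_, fun i j h hh => ?_⟩)
  · exact map_mem_closure (adjoint (R i)).continuous hh (hinv i)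
  · exact Set.EqOn.closure (hcomm i j) (by fun_prop) (by fun_prop) hh

theorem map_mem_maxQ_of_intertwine (q : Fin n → Fin n → ℂ) {R : Fin n → L →L[ℂ] L}
    {R' : Fin n → M →L[ℂ] M} (A : L →L[ℂ] M)
    (hA : ∀ i x, A (adjoint (R i) x) = adjoint (R' i) (A x)) {x : L} (hx : x ∈ maxQ q R) :
    A x ∈ maxQ q R' := by
  have h : (maxQ q R).map (A : L →ₗ[ℂ] M) ≤ maxQ q R' := by
    refine le_maxQ q ?_ ?_
    · rintro i _ ⟨h, hh, rfl⟩
      exact ⟨_, adjoint_mem_maxQ q R i hh, hA i h⟩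
    · rintro i j _ ⟨h, hh, rfl⟩
      have e := congrArg A ((isGreatest_maxQ q R).1.2.2 i j h hh)
      rw [map_smul] at e
      simpa [hA] using e
  exact h ⟨x, hx, rfl⟩

/-- A dilation which intertwines the tuples also intertwines the maximal `q`-commuting pieces. -/
theorem restrictEmbedding_intertwine (q : Fin n → Fin n → ℂ) {U : M →ₗᵢ[ℂ] L}
    {F : Fin n → M →L[ℂ] M} {V : Fin n → L →L[ℂ] L} (hU : IsDilation U F V)
    (hUV : ∀ i x, V i (U x) = U (F i x)) (i : Fin n) (x : maxQ q F) :
    maxPiece q V i (restrictEmbedding q hU x) = restrictEmbedding q hU (maxPiece q F i x) := by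
  have hadj : ∀ i y, adjoint U.toContinuousLinearMap (adjoint (V i) y)
      = adjoint (F i) (adjoint U.toContinuousLinearMap y) := by
    intro i y
    refine ext_inner_right ℂ fun z => ?_
    simp only [adjoint_inner_left]
    exact congrArg (inner ℂ y) (hUV i z)
  refine ext_inner_left ℂ fun y => ?_
  -- `U*` carries `maxQ q V` into `maxQ q F`, so pairing with `y` involves only the piece of `F`.
  have hu : adjoint U.toContinuousLinearMap (y : L) ∈ maxQ q F :=
    map_mem_maxQ_of_intertwine q _ hadj y.2
  calc inner ℂ y (maxPiece q V i (restrictEmbedding q hU x))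
      = inner ℂ (adjoint (V i) (y : L)) (U x) := by
        rw [← adjoint_inner_left, Submodule.coe_inner, coe_adjoint_maxPiece]; rfl
    _ = inner ℂ (adjoint (F i) (adjoint U.toContinuousLinearMap (y : L))) (x : M) := by
        rw [← hadj, adjoint_inner_left U.toContinuousLinearMap]; rfl
    _ = inner ℂ (adjoint (maxPiece q F i) ⟨_, hu⟩) x := by
        rw [Submodule.coe_inner, coe_adjoint_maxPiece]
    _ = inner ℂ (adjoint U.toContinuousLinearMap (y : L)) (maxPiece q F i x : M) := by
        rw [adjoint_inner_left]; rfl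
    _ = inner ℂ y (restrictEmbedding q hU (maxPiece q F i x)) := by
        rw [adjoint_inner_left]; rfl

end Maximal

/-! ### Copies of the full Fock space generated by wandering vectors. -/

section FockEmbedding

variable {n : ℕ} {L : Type*} [NormedAddCommGroup L] [InnerProductSpace ℂ L] [CompleteSpace L]

/-- The basis vector `e_{α₁} ⊗ ⋯ ⊗ e_{αₘ}` of the full Fock space. -/
def fockBasis (α : List (Fin n)) : FullFock n := lp.single 2 α (1 : ℂ)

theorem inner_fockBasis (α : List (Fin n)) (x : FullFock n) :
    inner ℂ (fockBasis α) x = x α := by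
  rw [fockBasis, lp.inner_single_left]; simp

theorem creation_fockBasis (i : Fin n) (α : List (Fin n)) :
    creation n i (fockBasis α) = fockBasis (i :: α) := by
  ext w
  change creationFun i (fockBasis α) w = _
  cases w with
  | nil => simp [creationFun, fockBasis, lp.single_apply]
  | cons j β =>
    by_cases hj : j = i <;>
      simp [creationFun, fockBasis, lp.single_apply, Pi.single_apply, hj]

theorem adjoint_creation_apply (i : Fin n) (x : FullFock n) (α : List (Fin n)) :
    adjoint (creation n i) x α = x (i :: α) := by
  rw [← inner_fockBasis, adjoint_inner_right, creation_fockBasis, inner_fockBasis]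

theorem isRowIsometry_creation : IsRowIsometry (creation n) := by
  intro i j x
  ext α
  rw [adjoint_creation_apply]
  change creationFun j x (i :: α) = _
  by_cases hij : i = j <;> simp [creationFun, hij]

theorem fockBasis_nil_mem_wandering : (fockBasis [] : FullFock n) ∈ wandering (creation n) := by
  rw [mem_wandering]
  intro i
  ext α
  rw [adjoint_creation_apply]
  simp [fockBasis, lp.single_apply]

omit [CompleteSpace L] in
theorem fock_ext {A B : FullFock n →L[ℂ] L} (h : ∀ α, A (fockBasis α) = B (fockBasis α)) :
    A = B := by
  ext x
  have hs : HasSum (fun α => lp.single 2 α (x α)) x := lp.hasSum_single (by norm_num) x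
  refine (hs.mapL A).unique ?_
  convert hs.mapL B using 2 with α
  have : (lp.single 2 α (x α) : FullFock n) = x α • fockBasis α := by
    rw [fockBasis, ← lp.single_smul]; simp
  rw [this, map_smul, map_smul, h]

variable {V : Fin n → L →L[ℂ] L}

theorem IsRowIsometry.orthonormal_wordProd (hV : IsRowIsometry V) {d : L} (hd : d ∈ wandering V)
    (h1 : ‖d‖ = 1) : Orthonormal ℂ fun α => wordProd V α d := by
  classical
  rw [orthonormal_iff_ite]
  intro α β
  rw [hV.inner_wordProd hd hd, inner_self_eq_norm_sq_to_K (𝕜 := ℂ) d, h1]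
  simp

/-- The copy `V^α d` of the full Fock space generated by a unit vector `d` of the wandering
subspace. -/
def fockEmbedding (hV : IsRowIsometry V) {d : L} (hd : d ∈ wandering V) (h1 : ‖d‖ = 1) :
    FullFock n →ₗᵢ[ℂ] L :=
  (hV.orthonormal_wordProd hd h1).orthogonalFamily.linearIsometry

theorem fockEmbedding_fockBasis (hV : IsRowIsometry V) {d : L} (hd : d ∈ wandering V)
    (h1 : ‖d‖ = 1) (α : List (Fin n)) :
    fockEmbedding hV hd h1 (fockBasis α) = wordProd V α d := by
  rw [fockEmbedding, fockBasis, OrthogonalFamily.linearIsometry_apply_single]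
  simp

theorem fockEmbedding_intertwine (hV : IsRowIsometry V) {d : L} (hd : d ∈ wandering V)
    (h1 : ‖d‖ = 1) (i : Fin n) (x : FullFock n) :
    V i (fockEmbedding hV hd h1 x) = fockEmbedding hV hd h1 (creation n i x) := by
  have : V i ∘L (fockEmbedding hV hd h1).toContinuousLinearMap
      = (fockEmbedding hV hd h1).toContinuousLinearMap ∘L creation n i := by
    refine fock_ext fun α => ?_
    simp [creation_fockBasis, fockEmbedding_fockBasis]
  exact DFunLike.congr_fun this x

/-- On basis vectors, `Vᵢ*` strips the first letter; the empty word is sent to `0` because `d` is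
wandering. Together with `fockEmbedding_intertwine` this says that the copy reduces `V`. -/
theorem isDilation_fockEmbedding (hV : IsRowIsometry V) {d : L} (hd : d ∈ wandering V)
    (h1 : ‖d‖ = 1) : IsDilation (fockEmbedding hV hd h1) (creation n) V := by
  intro i x
  have : adjoint (V i) ∘L (fockEmbedding hV hd h1).toContinuousLinearMap
      = (fockEmbedding hV hd h1).toContinuousLinearMap ∘L adjoint (creation n i) := by
    refine fock_ext fun α => ?_
    simp only [comp_apply, LinearIsometry.coe_toContinuousLinearMap, fockEmbedding_fockBasis]
    cases α with
    | nil =>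
      rw [mem_wandering.1 fockBasis_nil_mem_wandering, wordProd_nil, one_apply_eq_self,
        mem_wandering.1 hd, map_zero]
    | cons j α =>
      rw [wordProd_cons_apply, hV i j, ← creation_fockBasis, isRowIsometry_creation i j]
      split_ifs <;> simp [fockEmbedding_fockBasis]
  exact DFunLike.congr_fun this x

theorem inner_fockEmbedding_eq_zero (hV : IsRowIsometry V) {d : L} (hd : d ∈ wandering V)
    (h1 : ‖d‖ = 1) {y : L} (hy : ∀ α, inner ℂ y (wordProd V α d) = 0) (x : FullFock n) :
    inner ℂ y (fockEmbedding hV hd h1 x) = 0 := by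
  have : innerSL ℂ y ∘L (fockEmbedding hV hd h1).toContinuousLinearMap = 0 := by
    refine fock_ext fun α => ?_
    simp [fockEmbedding_fockBasis, hy]
  exact DFunLike.congr_fun this x

end FockEmbedding


/-! ### Ampliations along a Hilbert sum of copies. -/

section Ampliation

variable {K : Type*} {G : Type*} [NormedAddCommGroup G] [InnerProductSpace ℂ G]

theorem memℓp_ampliation (X : G →L[ℂ] G) (x : lp (fun _ : K => G) 2) :
    Memℓp (fun k => X (x k)) 2 := by
  refine (lp.memℓp ((‖X‖ : ℂ) • x)).mono' fun k => ?_
  rw [lp.coeFn_smul, Pi.smul_apply, norm_smul, Complex.norm_real, norm_norm]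
  exact X.le_opNorm (x k)

/-- The ampliation `X ⊗ I` acting on an `ℓ²`-sum of copies of a Hilbert space. -/
def ampliationCLM (X : G →L[ℂ] G) : lp (fun _ : K => G) 2 →L[ℂ] lp (fun _ : K => G) 2 :=
  LinearMap.mkContinuous
    { toFun := fun x => ⟨fun k => X (x k), memℓp_ampliation X x⟩
      map_add' := fun x y => by ext k; exact map_add X (x k) (y k)
      map_smul' := fun c x => by ext k; exact map_smul X c (x k) } ‖X‖ fun x => by
    have : ‖(‖X‖ : ℂ) • x‖ = ‖X‖ * ‖x‖ := by rw [norm_smul, Complex.norm_real, norm_norm]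
    rw [← this]
    refine lp.norm_mono (by norm_num) fun k => ?_
    rw [lp.coeFn_smul, Pi.smul_apply, norm_smul, Complex.norm_real, norm_norm]
    exact X.le_opNorm (x k)

theorem ampliationCLM_apply (X : G →L[ℂ] G) (x : lp (fun _ : K => G) 2) (k : K) :
    ampliationCLM X x k = X (x k) := rfl

/-- The `*`-homomorphism `X ↦ X ⊗ I`. -/
def ampliation [CompleteSpace G] :
    (G →L[ℂ] G) →⋆ₐ[ℂ] (lp (fun _ : K => G) 2 →L[ℂ] lp (fun _ : K => G) 2) where
  toFun := ampliationCLM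
  map_one' := by ext x k; simp [ampliationCLM_apply]
  map_mul' X Y := by ext x k; rfl
  map_zero' := by ext x k; simp [ampliationCLM_apply]
  map_add' X Y := by ext x k; simp [ampliationCLM_apply]
  commutes' c := by ext x k; simp [ampliationCLM_apply, Algebra.algebraMap_eq_smul_one]
  map_star' X := by
    rw [star_eq_adjoint, star_eq_adjoint, eq_adjoint_iff]
    intro x y
    rw [lp.inner_eq_tsum, lp.inner_eq_tsum]
    refine tsum_congr fun k => ?_
    rw [ampliationCLM_apply, ampliationCLM_apply, adjoint_inner_left]

theorem ampliation_single [CompleteSpace G] [DecidableEq K] (X : G →L[ℂ] G) (k : K) (x : G) :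
    ampliation (G := G) X (lp.single 2 k x : lp (fun _ : K => G) 2) = lp.single 2 k (X x) := by
  ext l
  rw [show ampliation (G := G) X (lp.single 2 k x : lp (fun _ : K => G) 2) l
    = X ((lp.single 2 k x : lp (fun _ : K => G) 2) l) from rfl]
  rw [lp.single_apply, lp.single_apply]
  by_cases h : l = k
  · subst h; simp
  · simp [h]

/-- Ampliation along an internal Hilbert sum of copies of `G`. -/
def hilbertSumAmpliation [CompleteSpace G] {E : Type*} [NormedAddCommGroup E]
    [InnerProductSpace ℂ E] [CompleteSpace E] {U : K → G →ₗᵢ[ℂ] E}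
    (hU : IsHilbertSum ℂ (fun _ : K => G) U) : (G →L[ℂ] G) →⋆ₐ[ℂ] (E →L[ℂ] E) :=
  hU.linearIsometryEquiv.symm.conjStarAlgEquiv.toStarAlgHom.comp ampliation

theorem hilbertSumAmpliation_apply [CompleteSpace G] {E : Type*} [NormedAddCommGroup E]
    [InnerProductSpace ℂ E] [CompleteSpace E] {U : K → G →ₗᵢ[ℂ] E}
    (hU : IsHilbertSum ℂ (fun _ : K => G) U) (X : G →L[ℂ] G) (k : K) (x : G) :
    hilbertSumAmpliation hU X (U k x) = U k (X x) := by
  classical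
  change hU.linearIsometryEquiv.symm (ampliation (G := G) X
    (hU.linearIsometryEquiv.symm.symm (U k x)))
    = _
  rw [← hU.linearIsometryEquiv_symm_apply_single x, LinearIsometryEquiv.symm_apply_apply,
    ampliation_single, hU.linearIsometryEquiv_symm_apply_single]

theorem IsHilbertSum.clm_ext [CompleteSpace G] {E : Type*} [NormedAddCommGroup E]
    [InnerProductSpace ℂ E] [CompleteSpace E] {U : K → G →ₗᵢ[ℂ] E}
    (hU : IsHilbertSum ℂ (fun _ : K => G) U) {A B : E →L[ℂ] E}
    (h : ∀ k x, A (U k x) = B (U k x)) : A = B := by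
  ext y
  have hs := hU.hasSum_linearIsometryEquiv_symm (hU.linearIsometryEquiv y)
  rw [LinearIsometryEquiv.symm_apply_apply] at hs
  refine (hs.mapL A).unique ?_
  convert hs.mapL B using 2
  exact h _ _

end Ampliation

/-! ### Representations of the generated C*-algebra. -/

section GeneratedCStar

theorem continuous_of_isClosed_starSubalgebra {A B : Type*} [CStarAlgebra A] [CStarAlgebra B]
    {S : StarSubalgebra ℂ A} (hS : IsClosed (S : Set A)) (π : S →⋆ₐ[ℂ] B) : Continuous π := by
  let _ : CStarAlgebra S := { toCompleteSpace := hS.completeSpace_coe }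
  refine AddMonoidHomClass.continuous_of_bound π 1 fun a => ?_
  rw [one_mul]
  exact NonUnitalStarAlgHom.norm_apply_le π a

variable {n : ℕ} {G E : Type*}
  [NormedAddCommGroup G] [InnerProductSpace ℂ G] [CompleteSpace G]
  [NormedAddCommGroup E] [InnerProductSpace ℂ E] [CompleteSpace E]

/-- An isometry which intertwines two tuples and their adjoints intertwines every representation
of the generated C*-algebra taking the first tuple to the second with the identity
representation. -/
theorem representation_intertwine {S : Fin n → G →L[ℂ] G} {W : Fin n → E →L[ℂ] E}
    {π : generatedCStar S →⋆ₐ[ℂ] (E →L[ℂ] E)} (hπ : ∀ i, π (generator S i) = W i)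
    (U : G →ₗᵢ[ℂ] E) (hU : ∀ i x, W i (U x) = U (S i x))
    (hU' : ∀ i x, adjoint (W i) (U x) = U (adjoint (S i) x)) (X : generatedCStar S) (x : G) :
    π X (U x) = U ((X : G →L[ℂ] G) x) := by
  have hle : StarAlgebra.adjoin ℂ (Set.range S) ≤ generatedCStar S :=
    StarSubalgebra.le_topologicalClosure _
  -- The claim is proved for `a` and `star a` together, since intertwining by `π a` alone does not
  -- pass to the adjoint.
  have hadj : ∀ a (ha : a ∈ StarAlgebra.adjoin ℂ (Set.range S)),
      (∀ x, π ⟨a, hle ha⟩ (U x) = U (a x)) ∧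
        ∀ x, π (star ⟨a, hle ha⟩) (U x) = U (star a x) := by
    intro a ha
    induction ha using StarAlgebra.adjoin_induction with
    | mem a h =>
      obtain ⟨i, rfl⟩ := h
      have e : (⟨S i, hle (StarAlgebra.subset_adjoin ℂ _ ⟨i, rfl⟩)⟩ : generatedCStar S)
        = generator S i := rfl
      rw [e, map_star, hπ]
      exact ⟨hU i, hU' i⟩
    | algebraMap r =>
      have e : (⟨algebraMap ℂ _ r, hle (algebraMap_mem _ r)⟩ : generatedCStar S)
        = algebraMap ℂ (generatedCStar S) r := rfl
      rw [e, map_star, AlgHomClass.commutes]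
      simp [Algebra.algebraMap_eq_smul_one]
    | add a b ha hb iha ihb =>
      have e : (⟨a + b, hle (add_mem ha hb)⟩ : generatedCStar S) = ⟨a, hle ha⟩ + ⟨b, hle hb⟩ :=
        rfl
      rw [e, star_add, star_add, map_add, map_add]
      exact ⟨fun x => by simp [iha.1, ihb.1],
        fun x => by simp only [add_apply, iha.2, ihb.2, map_add]⟩
    | mul a b ha hb iha ihb =>
      have e : (⟨a * b, hle (mul_mem ha hb)⟩ : generatedCStar S) = ⟨a, hle ha⟩ * ⟨b, hle hb⟩ :=
        rfl
      rw [e, star_mul, star_mul, map_mul, map_mul]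
      exact ⟨fun x => by simp only [mul_apply_eq_comp, iha.1, ihb.1],
        fun x => by simp only [mul_apply_eq_comp, iha.2, ihb.2]⟩
    | star a ha iha =>
      have e : (⟨star a, hle (star_mem ha)⟩ : generatedCStar S) = star ⟨a, hle ha⟩ := rfl
      rw [e, star_star, star_star]
      exact ⟨iha.2, iha.1⟩
  have hcont : Continuous π :=
    continuous_of_isClosed_starSubalgebra (StarSubalgebra.isClosed_topologicalClosure _) π
  have hclosed : IsClosed {X : generatedCStar S | π X (U x) = U ((X : G →L[ℂ] G) x)} := by
    refine isClosed_eq ?_ ?_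
    · exact (ContinuousLinearMap.apply ℂ _ (U x)).continuous.comp hcont
    · exact U.continuous.comp
        ((ContinuousLinearMap.apply ℂ _ x).continuous.comp continuous_subtype_val)
  have hdense : X ∈ closure {X : generatedCStar S |
      (X : G →L[ℂ] G) ∈ StarAlgebra.adjoin ℂ (Set.range S)} := by
    rw [closure_subtype]
    refine closure_mono ?_ (show (X : G →L[ℂ] G) ∈ closure
      (StarAlgebra.adjoin ℂ (Set.range S) : Set (G →L[ℂ] G)) from X.2)
    exact fun a ha => ⟨⟨a, hle ha⟩, ha, rfl⟩
  refine closure_minimal ?_ hclosed hdense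
  exact fun Y hY => (hadj Y hY).1 x

end GeneratedCStar

/-! ### The space of `V^q` as a Hilbert sum of `q`-commuting Fock spaces. -/

section Representation

variable {n : ℕ} (q : Fin n → Fin n → ℂ) {L : Type*}
  [NormedAddCommGroup L] [InnerProductSpace ℂ L] [CompleteSpace L] {V : Fin n → L →L[ℂ] L}

/-- The copy of the `q`-commuting Fock space in `maxQ q V` generated by a unit vector of the
wandering subspace. -/
def qFockEmbedding (hV : IsRowIsometry V) {d : L} (hd : d ∈ wandering V) (h1 : ‖d‖ = 1) :
    QFock q →ₗᵢ[ℂ] maxQ q V :=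
  restrictEmbedding q (isDilation_fockEmbedding hV hd h1)

theorem coe_qFockEmbedding (hV : IsRowIsometry V) {d : L} (hd : d ∈ wandering V) (h1 : ‖d‖ = 1)
    (x : QFock q) : (qFockEmbedding q hV hd h1 x : L) = fockEmbedding hV hd h1 x := rfl

theorem adjoint_maxPiece_qFockEmbedding (hV : IsRowIsometry V) {d : L} (hd : d ∈ wandering V)
    (h1 : ‖d‖ = 1) (i : Fin n) (x : QFock q) :
    adjoint (maxPiece q V i) (qFockEmbedding q hV hd h1 x)
      = qFockEmbedding q hV hd h1 (adjoint (qShift q i) x) :=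
  isDilation_restrictEmbedding q (isDilation_fockEmbedding hV hd h1) i x

theorem maxPiece_qFockEmbedding (hV : IsRowIsometry V) {d : L} (hd : d ∈ wandering V)
    (h1 : ‖d‖ = 1) (i : Fin n) (x : QFock q) :
    maxPiece q V i (qFockEmbedding q hV hd h1 x) = qFockEmbedding q hV hd h1 (qShift q i x) :=
  restrictEmbedding_intertwine q (isDilation_fockEmbedding hV hd h1)
    (fockEmbedding_intertwine hV hd h1) i x

/-- The vacuum vector as an element of the `q`-commuting Fock space. -/
def qVacuum : QFock q :=
  ⟨fockBasis [], wandering_le_maxQ q _ fockBasis_nil_mem_wandering⟩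

theorem coe_qFockEmbedding_qVacuum (hV : IsRowIsometry V) {d : L} (hd : d ∈ wandering V)
    (h1 : ‖d‖ = 1) : (qFockEmbedding q hV hd h1 (qVacuum q) : L) = d := by
  rw [coe_qFockEmbedding]
  exact fockEmbedding_fockBasis hV hd h1 []

theorem representation_qFockEmbedding {π : CStarS q →⋆ₐ[ℂ] (maxQ q V →L[ℂ] maxQ q V)}
    (hπ : ∀ i, π (qShiftGen q i) = maxPiece q V i) (hV : IsRowIsometry V) {d : L}
    (hd : d ∈ wandering V) (h1 : ‖d‖ = 1) (X : CStarS q) (x : QFock q) :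
    π X (qFockEmbedding q hV hd h1 x)
      = qFockEmbedding q hV hd h1 ((X : QFock q →L[ℂ] QFock q) x) :=
  representation_intertwine (S := qShift q) hπ _ (maxPiece_qFockEmbedding q hV hd h1)
    (adjoint_maxPiece_qFockEmbedding q hV hd h1) X x

/-- The copies come from an orthonormal basis of the wandering subspace. They are total because the
coordinates of `P (V^α)* y` in that basis are the Fock coordinates of `U* y`, and `hP` applies once
these vanish. -/
theorem exists_isHilbertSum_qFock (hV : IsRowIsometry V)
    (hP : ∀ y, (∀ α, wanderingProj V (adjoint (wordProd V α) y) = 0) → y = 0) :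
    ∃ (K : Set (wandering V)) (U : K → QFock q →ₗᵢ[ℂ] maxQ q V),
      IsHilbertSum ℂ (fun _ : K => QFock q) U ∧
      (∀ k i x, maxPiece q V i (U k x) = U k (qShift q i x)) := by
  obtain ⟨K, b, hb⟩ := exists_hilbertBasis ℂ (wandering V)
  have h1 : ∀ k : K, ‖((b k : wandering V) : L)‖ = 1 := fun k => b.orthonormal.1 k
  refine ⟨K, fun k => qFockEmbedding q hV (b k).2 (h1 k), IsHilbertSum.mk ?_ ?_, fun k i x =>
    maxPiece_qFockEmbedding q hV (b k).2 (h1 k) i x⟩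
  · intro k l hkl x y
    rw [Submodule.coe_inner, coe_qFockEmbedding, coe_qFockEmbedding]
    refine inner_fockEmbedding_eq_zero hV _ _ (fun α => ?_) _
    rw [inner_eq_zero_symm]
    refine inner_fockEmbedding_eq_zero hV _ _ (fun β => ?_) _
    rw [hV.inner_wordProd (b l).2 (b k).2]
    split_ifs
    · exact b.orthonormal.2 hkl.symm
    · rfl
  · rw [top_le_iff, Submodule.topologicalClosure_eq_top_iff, Submodule.eq_bot_iff]
    intro y hy
    have hU : ∀ k (x : QFock q), inner ℂ (qFockEmbedding q hV (b k).2 (h1 k) x) y = 0 :=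
      fun k x => (Submodule.mem_orthogonal _ _).1 hy _
        (Submodule.mem_iSup_of_mem k ⟨x, rfl⟩)
    apply Subtype.ext
    refine hP y fun α => ?_
    have hz := hV.wanderingProj_mem (adjoint (wordProd V α) (y : L))
    have hz0 : (⟨_, hz⟩ : wandering V) = 0 := by
      apply b.repr.injective
      ext k
      rw [b.repr_apply_apply, Submodule.coe_inner, ← inner_wanderingProj_left,
        wanderingProj_of_mem (b k).2, adjoint_inner_right,
        ← fockEmbedding_fockBasis hV (b k).2 (h1 k)]
      set U := fockEmbedding hV (b k).2 (h1 k)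
      have hu : adjoint U.toContinuousLinearMap (y : L) ∈ QFock q := by
        refine map_mem_maxQ_of_intertwine q _ (fun i z => ?_) y.2
        refine ext_inner_right ℂ fun w => ?_
        simp only [adjoint_inner_left]
        exact congrArg (inner ℂ z) (fockEmbedding_intertwine hV (b k).2 (h1 k) i w)
      -- Since `U* y` lies in `QFock q`, `U (U* y)` is in the copy, hence orthogonal to `y`; so `‖U*
      -- y‖² = 0`.
      have hu0 : adjoint U.toContinuousLinearMap (y : L) = 0 := by
        rw [← inner_self_eq_zero (𝕜 := ℂ), adjoint_inner_right]
        exact hU k ⟨_, hu⟩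
      have := adjoint_inner_right U.toContinuousLinearMap (fockBasis α) (y : L)
      rw [hu0, inner_zero_right] at this
      simpa using this.symm
    exact congrArg Subtype.val hz0

/-- The representation `X ↦ X ⊗ I` of `C*(S)` on the space of `V^q`. -/
theorem exists_representation (hV : IsRowIsometry V)
    (hP : ∀ y, (∀ α, wanderingProj V (adjoint (wordProd V α) y) = 0) → y = 0) :
    ∃ π : CStarS q →⋆ₐ[ℂ] (maxQ q V →L[ℂ] maxQ q V),
      ∀ i, π (qShiftGen q i) = maxPiece q V i := by
  obtain ⟨K, U, hU, hUV⟩ := exists_isHilbertSum_qFock q hV hP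
  refine ⟨(hilbertSumAmpliation hU).comp (CStarS q).subtype, fun i => ?_⟩
  refine IsHilbertSum.clm_ext hU fun k x => ?_
  rw [hUV]
  exact hilbertSumAmpliation_apply hU _ k x

end Representation


/-! ### Comparison of ranks and closures. -/

section Ranks

theorem mem_closure_image_iff_of_norm_eq {M X Y F₁ F₂ : Type*} [AddCommGroup M]
    [SeminormedAddCommGroup X] [SeminormedAddCommGroup Y] [FunLike F₁ M X]
    [AddMonoidHomClass F₁ M X] [FunLike F₂ M Y] [AddMonoidHomClass F₂ M Y] {A : F₁} {B : F₂}
    (h : ∀ x, ‖A x‖ = ‖B x‖) (s : Set M) (x : M) :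
    A x ∈ closure (A '' s) ↔ B x ∈ closure (B '' s) := by
  have hd : ∀ y, dist (A x) (A y) = dist (B x) (B y) := fun y => by
    rw [dist_eq_norm, dist_eq_norm, ← map_sub, ← map_sub, h]
  simp only [Metric.mem_closure_iff, Set.exists_mem_image, hd]

/-- Equal norms force equal kernels, so both ranges are the same quotient of `M`. -/
theorem toENat_rank_eq_of_norm_eq {M X Y : Type*} [AddCommGroup M] [Module ℂ M]
    [NormedAddCommGroup X] [NormedSpace ℂ X] [NormedAddCommGroup Y] [NormedSpace ℂ Y]
    {A : M →ₗ[ℂ] X} {B : M →ₗ[ℂ] Y} (h : ∀ x, ‖A x‖ = ‖B x‖) :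
    Cardinal.toENat (LinearMap.rank A) = Cardinal.toENat (LinearMap.rank B) := by
  have hk : LinearMap.ker A = LinearMap.ker B := by
    ext x
    rw [LinearMap.mem_ker, LinearMap.mem_ker, ← norm_eq_zero, h, norm_eq_zero]
  have e := (A.quotKerEquivRange.symm.trans
    ((Submodule.quotEquivOfEq _ _ hk).trans B.quotKerEquivRange)).lift_rank_eq
  simpa using congrArg Cardinal.toENat e

/-- A finite-dimensional subspace is closed, so here `N = P`. Otherwise both values are `⊤`:
`Cardinal.toENat` does not distinguish infinite cardinals, so algebraic rank is harmless. -/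
theorem toENat_rank_eq_of_dense {X : Type*} [NormedAddCommGroup X] [NormedSpace ℂ X]
    {N P : Submodule ℂ X} (hNP : N ≤ P) (hPN : P ≤ N.topologicalClosure) :
    Cardinal.toENat (Module.rank ℂ N) = Cardinal.toENat (Module.rank ℂ P) := by
  rcases lt_or_ge (Module.rank ℂ N) Cardinal.aleph0 with h | h
  · have : FiniteDimensional ℂ N := Module.rank_lt_aleph0_iff.1 h
    have hc : N.topologicalClosure = N :=
      (Submodule.closed_of_finiteDimensional N).submodule_topologicalClosure_eq
    rw [le_antisymm hNP (hc ▸ hPN)]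
  · rw [Cardinal.toENat_eq_top.2 h,
      Cardinal.toENat_eq_top.2 (h.trans (Submodule.rank_mono hNP))]

theorem eq_of_le_of_toENat_rank_eq {X : Type*} [AddCommGroup X] [Module ℂ X]
    {N P : Submodule ℂ X} (hNP : N ≤ P) (hfin : Cardinal.toENat (Module.rank ℂ P) ≠ ⊤)
    (h : Cardinal.toENat (Module.rank ℂ P) = Cardinal.toENat (Module.rank ℂ N)) : N = P := by
  have : FiniteDimensional ℂ P := by
    refine Module.rank_lt_aleph0_iff.1 (lt_of_not_ge fun hle => hfin ?_)
    exact Cardinal.toENat_eq_top.2 hle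
  refine Submodule.eq_of_le_of_finrank_eq hNP ?_
  rw [Module.finrank, Module.finrank, ← Cardinal.toNat_toENat, ← Cardinal.toNat_toENat, h]

end Ranks

/-! ### Compressions of representations. -/

section Compression

variable {A M E : Type*} [Ring A] [StarRing A] [Algebra ℂ A]
  [NormedAddCommGroup M] [InnerProductSpace ℂ M] [CompleteSpace M]
  [NormedAddCommGroup E] [InnerProductSpace ℂ E] [CompleteSpace E]

/-- The compression of a representation to the range of an isometry. -/
def compression (π : A →⋆ₐ[ℂ] (E →L[ℂ] E)) (J : M →ₗᵢ[ℂ] E) : A →ₗ[ℂ] (M →L[ℂ] M) where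
  toFun X := adjoint J.toContinuousLinearMap ∘L π X ∘L J.toContinuousLinearMap
  map_add' X Y := by rw [map_add]; ext x; simp
  map_smul' c X := by rw [map_smul]; ext x; simp

theorem inner_compression (π : A →⋆ₐ[ℂ] (E →L[ℂ] E)) (J : M →ₗᵢ[ℂ] E) (X : A) (x y : M) :
    inner ℂ y (compression π J X x) = inner ℂ (J y) (π X (J x)) :=
  adjoint_inner_right J.toContinuousLinearMap y (π X (J x))

theorem compression_one (π : A →⋆ₐ[ℂ] (E →L[ℂ] E)) (J : M →ₗᵢ[ℂ] E) : compression π J 1 = 1 := by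
  refine ContinuousLinearMap.ext fun x => ext_inner_left ℂ fun y => ?_
  rw [inner_compression, map_one, one_apply_eq_self, one_apply_eq_self, J.inner_map_map]

-- The double sum is `‖∑ π(Xᵢ) J hᵢ‖²`.
open scoped ComplexOrder in
theorem compression_nonneg (π : A →⋆ₐ[ℂ] (E →L[ℂ] E)) (J : M →ₗᵢ[ℂ] E) (k : ℕ) (X : Fin k → A)
    (h : Fin k → M) : 0 ≤ ∑ i, ∑ j, inner ℂ (h i) (compression π J (star (X i) * X j) (h j)) := by
  have : ∑ i, ∑ j, inner ℂ (h i) (compression π J (star (X i) * X j) (h j)) =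
      inner ℂ (∑ i, π (X i) (J (h i))) (∑ j, π (X j) (J (h j))) := by
    rw [sum_inner]
    refine Finset.sum_congr rfl fun i _ => ?_
    rw [inner_sum]
    refine Finset.sum_congr rfl fun j _ => ?_
    rw [inner_compression, map_mul, map_star, star_eq_adjoint, mul_apply_eq_comp,
      adjoint_inner_right]
  rw [this, inner_self_eq_norm_sq_to_K (𝕜 := ℂ)]
  rw [← RCLike.ofReal_pow]
  exact RCLike.ofReal_nonneg.2 (sq_nonneg _)

variable {n : ℕ} {G : Type*} [NormedAddCommGroup G] [InnerProductSpace ℂ G] [CompleteSpace G]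
  {S : Fin n → G →L[ℂ] G} {T : Fin n → M →L[ℂ] M} {W : Fin n → E →L[ℂ] E}
  {π : generatedCStar S →⋆ₐ[ℂ] (E →L[ℂ] E)}

theorem representation_wordProd (hπ : ∀ i, π (generator S i) = W i) (α : List (Fin n)) :
    π (wordProd (generator S) α) = wordProd W α := by
  rw [map_wordProd]
  simp only [hπ]

theorem compression_wordProd (hπ : ∀ i, π (generator S i) = W i) {J : M →ₗᵢ[ℂ] E}
    (hJ : IsDilation J T W) (α β : List (Fin n)) :
    compression π J (wordProd (generator S) α * star (wordProd (generator S) β))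
      = wordProd T α * adjoint (wordProd T β) := by
  refine ContinuousLinearMap.ext fun x => ext_inner_left ℂ fun y => ?_
  rw [inner_compression, map_mul, map_star, representation_wordProd hπ,
    representation_wordProd hπ, star_eq_adjoint, mul_apply_eq_comp, hJ.wordProd,
    ← adjoint_inner_left, hJ.wordProd, J.inner_map_map, adjoint_inner_left, mul_apply_eq_comp]

omit [CompleteSpace M] in
theorem inner_wanderingProj_of_orthogonal (hπ : ∀ i, π (generator S i) = W i) (J : M →ₗᵢ[ℂ] E)
    {y : E} (hy : ∀ X h, inner ℂ (π X (J h)) y = 0) (α : List (Fin n)) (h : M) :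
    inner ℂ (adjoint (wordProd W α) y) (wanderingProj W (J h)) = 0 := by
  -- `π` sends this element to `W^α` times `wanderingProj W`.
  have hX := hy (wordProd (generator S) α * (1 - ∑ i, generator S i * star (generator S i))) h
  have hE : π (1 - ∑ i, generator S i * star (generator S i)) = wanderingProj W := by
    simp only [map_sub, map_one, map_sum, map_mul, map_star, hπ]
    rfl
  rw [map_mul, representation_wordProd hπ, hE, mul_apply_eq_comp, ← adjoint_inner_right] at hX
  exact inner_eq_zero_symm.1 hX

end Compression

/-! ### The density criterion, minimality of the dilation, and the ranks. -/

section Main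

variable {n : ℕ} {q : Fin n → Fin n → ℂ} {H L : Type*}
  [NormedAddCommGroup H] [InnerProductSpace ℂ H] [CompleteSpace H]
  [NormedAddCommGroup L] [InnerProductSpace ℂ L] [CompleteSpace L]
  {J : H →ₗᵢ[ℂ] L} {T : Fin n → H →L[ℂ] H} {V : Fin n → L →L[ℂ] L}

/-- If `u` is orthogonal to `N`, so is its wandering component, which then vanishes by `h0`; hence
`Nᗮ` is orthogonal to the wandering subspace. -/
theorem IsRowIsometry.wandering_le_topologicalClosure (hV : IsRowIsometry V) {N : Submodule ℂ L}
    (hN : N ≤ wandering V)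
    (h0 : ∀ d ∈ wandering V, (∀ u ∈ N, inner ℂ u d = 0) → d = 0) :
    wandering V ≤ N.topologicalClosure := by
  intro z hz
  rw [← Submodule.orthogonal_orthogonal_eq_closure, Submodule.mem_orthogonal]
  intro u hu
  have h := h0 _ (hV.wanderingProj_mem u) fun v hv => by
    rw [← inner_wanderingProj_left, wanderingProj_of_mem (hN hv)]
    exact hu v hv
  rw [← wanderingProj_of_mem hz, ← inner_wanderingProj_left, h, inner_zero_left]

theorem IsRowIsometry.range_wanderingProj (hV : IsRowIsometry V) :
    LinearMap.range (wanderingProj V : L →ₗ[ℂ] L) = wandering V := by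
  apply le_antisymm
  · rintro _ ⟨x, rfl⟩
    exact hV.wanderingProj_mem x
  · intro d hd
    exact ⟨d, wanderingProj_of_mem hd⟩

omit [CompleteSpace H] in
theorem closure_range_eq_iff (A : H →L[ℂ] H) (N : Submodule ℂ H) :
    closure (Set.range A) = closure (A '' (N : Set H)) ↔
      ∀ h, A h ∈ closure (A '' (N : Set H)) := by
  constructor
  · intro e h
    exact e ▸ subset_closure ⟨h, rfl⟩
  · intro hA
    refine subset_antisymm (closure_minimal ?_ isClosed_closure)
      (closure_mono (Set.image_subset_range _ _))
    rintro _ ⟨h, rfl⟩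
    exact hA h

/-- The density condition on the defect operator says that no vector of the wandering subspace is
orthogonal to the compressions of the vectors of `N`. -/
theorem IsStandardNoncommutingDilation.closure_range_defect_eq_iff
    (hV : IsStandardNoncommutingDilation J T V) (hT : IsContractive T) (N : Submodule ℂ H) :
    closure (Set.range (defect T)) = closure (defect T '' (N : Set H)) ↔
      ∀ d ∈ wandering V, (∀ h ∈ N, inner ℂ (wanderingProj V (J h)) d = 0) → d = 0 := by
  have hR := hV.isRowIsometry
  set B : H →L[ℂ] L := wanderingProj V ∘L J.toContinuousLinearMap
  have hB : ∀ h, ‖defect T h‖ = ‖B h‖ :=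
    fun h => (hR.norm_wanderingProj_of_isDilation hT hV.dilation h).symm
  rw [closure_range_eq_iff]
  -- Membership in these closures depends only on norms of differences, so `defect T` may be
  -- replaced by `B`.
  simp only [mem_closure_image_iff_of_norm_eq hB]
  constructor
  · intro hcl d hd h0
    refine hV.eq_zero_of_mem_wandering hd fun h => ?_
    have hc : IsClosed {z : L | inner ℂ z d = 0} := isClosed_eq (by fun_prop) (by fun_prop)
    refine closure_minimal ?_ hc (hcl h)
    rintro _ ⟨h', hh', rfl⟩
    exact h0 h' hh'
  · intro h0 h
    have hle : N.map (B : H →ₗ[ℂ] L) ≤ wandering V := by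
      rintro _ ⟨h', -, rfl⟩
      exact hR.wanderingProj_mem _
    refine hR.wandering_le_topologicalClosure hle (fun d hd hd0 => h0 d hd fun h' hh' => ?_)
      (hR.wanderingProj_mem (J h))
    exact hd0 _ ⟨h', hh', rfl⟩

theorem inner_wanderingProj_maxPiece (z x : maxQ q V) :
    inner ℂ z (wanderingProj (maxPiece q V) x) = inner ℂ (z : L) (wanderingProj V x) := by
  rw [wanderingProj_apply, wanderingProj_apply, inner_sub_right, inner_sub_right, inner_sum,
    inner_sum, Submodule.coe_inner]
  congr 1
  refine Finset.sum_congr rfl fun i _ => ?_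
  rw [← adjoint_inner_left (maxPiece q V i), ← adjoint_inner_left (V i), Submodule.coe_inner,
    coe_adjoint_maxPiece, coe_adjoint_maxPiece]

/-- A nonzero `d`, once normalised, would be the vacuum of a copy of `QFock q` orthogonal to the
generating span, against minimality. -/
theorem eq_zero_of_isStandardQCommutingDilation {hJ : IsDilation J T V} (hR : IsRowIsometry V)
    (h : IsStandardQCommutingDilation q (restrictEmbedding q hJ) (maxPiece q T) (maxPiece q V))
    {d : L} (hd : d ∈ wandering V)
    (h0 : ∀ h ∈ maxQ q T, inner ℂ (wanderingProj V (J h)) d = 0) : d = 0 := by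
  obtain ⟨φ, π, -, -, -, -, hmin, hπ⟩ := h
  by_contra hne
  have hne' : ‖d‖ ≠ 0 := norm_ne_zero_iff.2 hne
  set e : L := ((‖d‖⁻¹ : ℝ) : ℂ) • d
  have he : e ∈ wandering V := (wandering V).smul_mem _ hd
  have h1 : ‖e‖ = 1 := by
    rw [norm_smul, Complex.norm_real, norm_inv, norm_norm, inv_mul_cancel₀ hne']
  -- `h0` controls only vectors of `maxQ q T`, and it is needed for all `(T^β)* h`.
  have hq : ∀ β, ∀ h ∈ maxQ q T, adjoint (wordProd T β) h ∈ maxQ q T := by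
    intro β
    induction β with
    | nil => intro h hh; simpa using hh
    | cons i β ih =>
      intro h hh
      rw [adjoint_wordProd_cons_apply]
      exact ih _ (adjoint_mem_maxQ q T i hh)
  set U := qFockEmbedding q hR he h1
  have horth : U (qVacuum q) ∈ (Submodule.span ℂ {x : maxQ q V |
      ∃ (X : CStarS q) (h : maxQ q T), x = π X (restrictEmbedding q hJ h)})ᗮ := by
    rw [Submodule.mem_orthogonal]
    intro u hu
    induction hu using Submodule.span_induction with
    | mem x hx =>
      obtain ⟨X, h, rfl⟩ := hx
      -- Moving `π X` across gives `π (star X)`, which keeps the vacuum inside its copy; it remains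
      -- to see that `J h` is orthogonal to the whole Fock copy of `e`.
      rw [← adjoint_inner_right, ← star_eq_adjoint, ← map_star,
        representation_qFockEmbedding q hπ hR he h1, Submodule.coe_inner, coe_qFockEmbedding]
      refine inner_fockEmbedding_eq_zero hR he h1 (fun α => ?_) _
      rw [inner_eq_zero_symm]
      refine inner_wordProd_of_mem_wandering hJ he (fun β => ?_) α
      rw [inner_eq_zero_symm, inner_smul_right]
      exact mul_eq_zero_of_right _ (h0 _ (hq β h h.2))
    | zero => simp
    | add a b _ _ ha hb => rw [inner_add_left, ha, hb, add_zero]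
    | smul c a _ ha => rw [inner_smul_left, ha, mul_zero]
  rw [Submodule.topologicalClosure_eq_top_iff.1 hmin, Submodule.mem_bot] at horth
  have hz := congrArg Subtype.val horth
  rw [coe_qFockEmbedding_qVacuum] at hz
  rw [hz] at h1
  simp at h1

/-- Purity is used twice: to construct `π`, and to conclude `y = 0` from the vanishing of all `P
(V^α)* y`. -/
theorem IsStandardNoncommutingDilation.isStandardQCommutingDilation
    (hV : IsStandardNoncommutingDilation J T V) (hpure : IsPure T)
    (h0 : ∀ d ∈ wandering V,
      (∀ h ∈ maxQ q T, inner ℂ (wanderingProj V (J h)) d = 0) → d = 0) :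
    IsStandardQCommutingDilation q (restrictEmbedding q hV.dilation) (maxPiece q T)
      (maxPiece q V) := by
  have hR := hV.isRowIsometry
  obtain ⟨π, hπ⟩ := exists_representation q hR fun y hy => hV.eq_zero_of_wanderingProj hpure hy
  have hJ' := isDilation_restrictEmbedding q hV.dilation
  refine ⟨compression π (restrictEmbedding q hV.dilation),
    π, compression_one π _, compression_nonneg π _,
    compression_wordProd (S := qShift q) hπ hJ', fun _ => rfl, ?_, hπ⟩
  rw [Submodule.topologicalClosure_eq_top_iff, Submodule.eq_bot_iff]
  intro y hy
  apply Subtype.ext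
  refine hV.eq_zero_of_wanderingProj hpure fun α => ?_
  refine h0 _ (hR.wanderingProj_mem _) fun h hh => ?_
  have hX := inner_wanderingProj_of_orthogonal (S := qShift q) hπ (restrictEmbedding q hV.dilation)
    (y := y) (fun X h => (Submodule.mem_orthogonal _ _).1 hy _ (Submodule.subset_span ⟨X, h, rfl⟩))
    α ⟨h, hh⟩
  rw [inner_wanderingProj_maxPiece] at hX
  have hc : ((adjoint (wordProd (maxPiece q V) α) y : maxQ q V) : L)
      = adjoint (wordProd V α) (y : L) :=
    ((isDilation_subtype_maxQ q V).wordProd α y).symm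
  rw [hc] at hX
  rw [← inner_wanderingProj_left, wanderingProj_of_mem (hR.wanderingProj_mem _),
    inner_eq_zero_symm]
  exact hX

theorem opRank_defect_maxPiece (hT : IsContractive T) :
    opRank (defect (maxPiece q T)) = Cardinal.toENat (Module.rank ℂ
      ((maxQ q T).map (defect T : H →ₗ[ℂ] H))) := by
  have h : ∀ x, ‖(defect (maxPiece q T) : maxQ q T →ₗ[ℂ] maxQ q T) x‖
      = ‖((defect T : H →ₗ[ℂ] H) ∘ₗ (maxQ q T).subtype) x‖ := norm_defect_maxPiece q hT
  rw [opRank, toENat_rank_eq_of_norm_eq h, LinearMap.rank, LinearMap.range_comp,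
    Submodule.range_subtype]

theorem IsRowIsometry.opRank_defect (hR : IsRowIsometry V) :
    opRank (defect V) = Cardinal.toENat (Module.rank ℂ (wandering V)) := by
  have h : ∀ x, ‖(defect V : L →ₗ[ℂ] L) x‖ = ‖(wanderingProj V : L →ₗ[ℂ] L) x‖ := hR.norm_defect
  rw [opRank, toENat_rank_eq_of_norm_eq h, LinearMap.rank, hR.range_wanderingProj]

theorem IsRowIsometry.opRank_defect_maxPiece (hR : IsRowIsometry V) :
    opRank (defect (maxPiece q V)) = Cardinal.toENat (Module.rank ℂ (wandering V)) := by
  have h : ∀ x, ‖(defect (maxPiece q V) : maxQ q V →ₗ[ℂ] maxQ q V) x‖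
      = ‖((wanderingProj V : L →ₗ[ℂ] L) ∘ₗ (maxQ q V).subtype) x‖ := fun x =>
    (norm_defect_maxPiece q hR.isContractive x).trans (hR.norm_defect x)
  have hrange : LinearMap.range ((wanderingProj V : L →ₗ[ℂ] L) ∘ₗ (maxQ q V).subtype)
      = wandering V := by
    apply le_antisymm
    · rintro _ ⟨x, rfl⟩
      exact hR.wanderingProj_mem x
    · intro d hd
      -- Restricting to `maxQ q V` loses nothing, as it contains the wandering subspace.
      exact ⟨⟨d, wandering_le_maxQ q V hd⟩, wanderingProj_of_mem hd⟩
  rw [opRank, toENat_rank_eq_of_norm_eq h, LinearMap.rank, hrange]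

/-- Minimality makes the compressions of `J H` dense in the wandering subspace, and a dense subspace
has the same rank in `ℕ∞`. -/
theorem IsStandardNoncommutingDilation.opRank_defect (hV : IsStandardNoncommutingDilation J T V)
    (hT : IsContractive T) : opRank (defect T) = opRank (defect V) := by
  have hR := hV.isRowIsometry
  have h : ∀ x, ‖(defect T : H →ₗ[ℂ] H) x‖
      = ‖((wanderingProj V : L →ₗ[ℂ] L) ∘ₗ J.toLinearMap) x‖ :=
    fun x => (hR.norm_wanderingProj_of_isDilation hT hV.dilation x).symm
  have hle : LinearMap.range ((wanderingProj V : L →ₗ[ℂ] L) ∘ₗ J.toLinearMap) ≤ wandering V := by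
    rintro _ ⟨x, rfl⟩
    exact hR.wanderingProj_mem _
  rw [opRank, toENat_rank_eq_of_norm_eq h, hR.opRank_defect, LinearMap.rank]
  refine toENat_rank_eq_of_dense hle (hR.wandering_le_topologicalClosure hle fun d hd hd0 => ?_)
  exact hV.eq_zero_of_mem_wandering hd fun h => hd0 _ ⟨h, rfl⟩

theorem opRank_defect_eq_of_closure_eq (hT : IsContractive T)
    (h : closure (Set.range (defect T)) = closure (defect T '' (maxQ q T : Set H))) :
    opRank (defect T) = opRank (defect (maxPiece q T)) := by
  rw [opRank_defect_maxPiece hT, opRank, LinearMap.rank]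
  refine (toENat_rank_eq_of_dense LinearMap.map_le_range ?_).symm
  rintro _ ⟨x, rfl⟩
  exact (closure_range_eq_iff _ _).1 h x

theorem closure_eq_of_opRank_defect_eq (hT : IsContractive T) (hfin : opRank (defect T) ≠ ⊤)
    (h : opRank (defect T) = opRank (defect (maxPiece q T))) :
    closure (Set.range (defect T)) = closure (defect T '' (maxQ q T : Set H)) := by
  rw [opRank_defect_maxPiece hT] at h
  have e := eq_of_le_of_toENat_rank_eq LinearMap.map_le_range hfin h
  exact congrArg closure (congrArg SetLike.coe e.symm)

end Main

end QDilation

end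

theorem theorem18 {n : ℕ} (q : Fin n → Fin n → ℂ)
    (hq_norm : ∀ i j, ‖q i j‖ = 1) (hq_diag : ∀ i, q i i = 1)
    (hq_inv : ∀ i j, q j i = (q i j)⁻¹)
    {H L : Type*}
    [NormedAddCommGroup H] [InnerProductSpace ℂ H] [CompleteSpace H]
    [TopologicalSpace.SeparableSpace H]
    [NormedAddCommGroup L] [InnerProductSpace ℂ L] [CompleteSpace L]
    (T : Fin n → H →L[ℂ] H)
    (hT : QDilation.IsContractive T) (hpure : QDilation.IsPure T)
    (J : H →ₗᵢ[ℂ] L) (V : Fin n → L →L[ℂ] L)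
    (hV : QDilation.IsStandardNoncommutingDilation J T V) :
    (QDilation.IsStandardQCommutingDilation q
        (QDilation.restrictEmbedding q hV.dilation)
        (QDilation.maxPiece q T) (QDilation.maxPiece q V) ↔
      closure (Set.range (QDilation.defect T)) =
        closure (QDilation.defect T '' (QDilation.maxQ q T : Set H))) ∧
    (closure (Set.range (QDilation.defect T)) =
        closure (QDilation.defect T '' (QDilation.maxQ q T : Set H)) →
      QDilation.opRank (QDilation.defect T) =
          QDilation.opRank (QDilation.defect (QDilation.maxPiece q T)) ∧
        QDilation.opRank (QDilation.defect (QDilation.maxPiece q T)) =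
          QDilation.opRank (QDilation.defect V) ∧
        QDilation.opRank (QDilation.defect V) =
          QDilation.opRank (QDilation.defect (QDilation.maxPiece q V))) ∧
    (QDilation.opRank (QDilation.defect T) ≠ ⊤ →
      QDilation.opRank (QDilation.defect (QDilation.maxPiece q T)) ≠ ⊤ →
      QDilation.opRank (QDilation.defect T) =
        QDilation.opRank (QDilation.defect (QDilation.maxPiece q T)) →
      QDilation.IsStandardQCommutingDilation q
        (QDilation.restrictEmbedding q hV.dilation)
        (QDilation.maxPiece q T) (QDilation.maxPiece q V)) := by
  have key := hV.closure_range_defect_eq_iff hT (QDilation.maxQ q T)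
  have hcl := fun h => hV.isStandardQCommutingDilation (q := q) hpure (key.1 h)
  refine ⟨⟨fun h => key.2 fun d hd h0 => ?_, hcl⟩, fun h => ⟨?_, ?_, ?_⟩,
    fun hfin _ h => hcl (QDilation.closure_eq_of_opRank_defect_eq hT hfin h)⟩
  · exact QDilation.eq_zero_of_isStandardQCommutingDilation hV.isRowIsometry h hd h0
  · exact QDilation.opRank_defect_eq_of_closure_eq hT h
  · rw [← QDilation.opRank_defect_eq_of_closure_eq hT h, hV.opRank_defect hT]
  · rw [hV.isRowIsometry.opRank_defect, hV.isRowIsometry.opRank_defect_maxPiece]
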